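/- Let $k$ be a field, regarded as a discrete topological ring. *Coalgebras.* For a $k$-coalgebra $C$ let $C_0$ (the coradical) be the sum of the simple left subcomodules of $C$ and put $C_1=\Delta^{-1}(C\otimes C_0+C_0\otimes C)$. $C$ is pointed if every simple subcoalgebra of $C$ is one-dimensional; $\mathrm{PCog}$ is the category of pointed coalgebras and coalgebra homomorphisms. For homomorphisms $\rho,\gamma:C\to D$ in $\mathrm{PCog}$ write $\rho\sim\gamma$ if $(\rho-\gamma)(C_0)=0$ and $(\rho-\gamma)(C_1)\subseteq D_0$. *Algebras.* A pseudocompact algebra is an associative, unital, Hausdorff topological $k$-algebra $A$ having a basis of neighbourhoods of $0$ consisting of open two-sided ideals $I$ of finite codimension, and such that $A\cong\varprojlim_I A/I$. Let $J(A)$ be the intersection of the maximal closed left ideals of $A$, and $J^2(A)$ the intersection of the maximal closed left $A$-submodules of $J(A)$ (an empty intersection being $A$, respectively $J(A)$). $A$ is pointed if $A/M$ is one-dimensional for every maximal closed left ideal $M$; $\mathrm{PAlg}$ is the category of pointed pseudocompact algebras and continuous algebra homomorphisms. For $\alpha,\beta:A\to B$ in $\mathrm{PAlg}$ write $\alpha\sim\beta$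 if $(\alpha-\beta)(A)\subseteq J(B)$ and $(\alpha-\beta)(J(A))\subseteq J^2(B)$. *Duals.* For a coalgebra $C$ let $C^*=\mathrm{Hom}_k(C,k)$ with the convolution product and the topology of pointwise convergence; for a pseudocompact algebra $A$ let $A^*$ be the space of continuous linear functionals $A\to k$, with the coalgebra structure determined by $\varepsilon(f)=f(1)$ and, writing $\Delta(f)=\sum f_1\otimes f_2$, $\sum f_1(a)f_2(b)=f(ab)$ for all $a,b\in A$. On morphisms $(-)^*$ is precomposition. **Proposition.** The relations $\sim$ are congruences on $\mathrm{PCog}$ and on $\mathrm{PAlg}$; let $\mathrm{PCog}_\sim$ and $\mathrm{PAlg}_\sim$ be the quotient categories. The contravariant functors $(-)^*$ send pointed coalgebras to pointed pseudocompact algebras and conversely, and form a duality (mutually quasi-inverse contravariant equivalences) between $\mathrm{PCog}$ and $\mathrm{PAlg}$. They preserve and reflect $\sim$: for parallel morphisms $\rho,\gamma$ of $\mathrm{PCog}$, $\rho\sim\gamma$ if and only if $\rho^*\sim\gamma^*$, and for parallel morphisms $\alpha,\beta$ of $\mathrm{PAlg}$, $\alpha\sim\beta$ if and only if $\alpha^*\sim\beta^*$.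 Consequently they induce functors $\mathrm{PCog}_\sim^{\mathrm{op}}\to\mathrm{PAlg}_\sim$ and $\mathrm{PAlg}_\sim^{\mathrm{op}}\to\mathrm{PCog}_\sim$, compatible with the projection functors to the quotients, and these form a duality between $\mathrm{PCog}_\sim$ and $\mathrm{PAlg}_\sim$. -/

import Mathlib

open CategoryTheory TensorProduct Topology

universe u

set_option linter.unusedSectionVars false

noncomputable section

namespace PointedDuality

section Coalgebra

variable (k : Type u) [Field k] {C : Type u} [AddCommGroup C] [Module k C] [Coalgebra k C]

/-- `V` is a left subcomodule of `C`, i.e. `Δ(V) ⊆ C ⊗ V`. -/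
def IsLeftSubcomodule (V : Submodule k C) : Prop :=
  ∀ v ∈ V, Coalgebra.comul (R := k) v ∈ LinearMap.range (V.subtype.lTensor C)

/-- `D` is a subcoalgebra of `C`, i.e. `Δ(D) ⊆ D ⊗ D`. -/
def IsSubcoalgebra (D : Submodule k C) : Prop :=
  ∀ d ∈ D, Coalgebra.comul (R := k) d ∈ LinearMap.range (TensorProduct.map D.subtype D.subtype)

/-- `V` is a simple left subcomodule of `C`. -/
def IsSimpleLeftSubcomodule (V : Submodule k C) : Prop :=
  Minimal (fun W : Submodule k C => IsLeftSubcomodule k W ∧ W ≠ ⊥) V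

/-- `D` is a simple subcoalgebra of `C`. -/
def IsSimpleSubcoalgebra (D : Submodule k C) : Prop :=
  Minimal (fun E : Submodule k C => IsSubcoalgebra k E ∧ E ≠ ⊥) D

variable (C) in
/-- The coradical `C₀`: the sum of the simple left subcomodules of `C`. -/
def coradical : Submodule k C := sSup {V : Submodule k C | IsSimpleLeftSubcomodule k V}

variable (C) in
/-- The coradical filtration: `C₀` is the coradical, and `Cₙ₊₁ = Δ⁻¹(C ⊗ Cₙ + C₀ ⊗ C)`. -/
def coradFil : ℕ → Submodule k C
  | 0 => coradical k C
  | n + 1 => Submodule.comap (Coalgebra.comul (R := k) (A := C))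
      (LinearMap.range ((coradFil n).subtype.lTensor C) ⊔
        LinearMap.range ((coradical k C).subtype.rTensor C))

variable (C) in
/-- A coalgebra is pointed if every simple subcoalgebra is one-dimensional. -/
def IsPointedCoalgebra : Prop :=
  ∀ D : Submodule k C, IsSimpleSubcoalgebra k D → Module.finrank k D = 1

variable {k} in
/-- The relation `ρ ∼ γ` on coalgebra homomorphisms:
`(ρ - γ)(C₀) = 0` and `(ρ - γ)(C₁) ⊆ D₀`. -/
def CoalgClose {D : Type u} [AddCommGroup D] [Module k D] [Coalgebra k D]
    (ρ γ : C →ₗc[k] D) : Prop :=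
  (∀ x ∈ coradFil k C 0, ρ x - γ x = 0) ∧ ∀ x ∈ coradFil k C 1, ρ x - γ x ∈ coradFil k D 0

end Coalgebra

section Algebra

variable (k : Type u) [Field k] {A : Type u} [Ring A] [Algebra k A] [TopologicalSpace A]

/-- `I` is an open two-sided ideal of finite codimension. -/
def IsOpenCofinite (I : Ideal A) : Prop :=
  I.IsTwoSided ∧ IsOpen (I : Set A) ∧ Module.Finite k (A ⧸ I)

variable (A) in
/-- Pseudocompact `k`-algebras (`k` discrete): Hausdorff topological algebras having a basis of
neighbourhoods of `0` consisting of open two-sided ideals `I` of finite codimension, and such that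
the canonical map `A → lim A ⧸ I` is bijective. Injectivity is the Hausdorff property.
Surjectivity is `complete`: an element of the inverse limit is given by representatives `x I`.
That the map is a homeomorphism, and that scalar multiplication `k × A → A` is continuous for the
discrete topology on `k`, is then automatic. -/
class IsPseudocompact : Prop extends IsTopologicalRing A, T2Space A where
  exists_ideal_subset : ∀ U ∈ 𝓝 (0 : A), ∃ I : Ideal A, IsOpenCofinite k I ∧ (I : Set A) ⊆ U
  complete : ∀ x : Ideal A → A,
    (∀ I J : Ideal A, IsOpenCofinite k I → IsOpenCofinite k J → I ≤ J → x I - x J ∈ J) →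
      ∃ a : A, ∀ I : Ideal A, IsOpenCofinite k I → a - x I ∈ I

/-- `N` is a maximal closed `A`-submodule of the left ideal `L`: it is maximal among the closed
left ideals properly contained in `L`. -/
def IsMaximalClosedIn (L N : Ideal A) : Prop :=
  Maximal (fun N : Ideal A => IsClosed (N : Set A) ∧ N < L) N

/-- `Rad(L)`: the intersection of the maximal closed submodules of the left ideal `L`
(all of `L` if there are none). -/
def rad (L : Ideal A) : Ideal A :=
  L ⊓ sInf {N : Ideal A | IsMaximalClosedIn L N}

variable (A) in
/-- The radicals `Jⁿ(A)`: `J⁰(A) = A`, `J¹(A) = J(A)` is the intersection of the maximal closed left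
ideals of `A`, and `Jⁿ⁺¹(A) = Rad(Jⁿ(A))`. -/
def J : ℕ → Ideal A
  | 0 => ⊤
  | n + 1 => rad (J n)

variable (A) in
/-- A pseudocompact algebra is pointed if every quotient by a maximal closed left ideal is
one-dimensional. -/
def IsPointedAlgebra : Prop :=
  ∀ M : Ideal A, IsMaximalClosedIn ⊤ M → Module.finrank k (A ⧸ M) = 1

variable {k} in
/-- The relation `α ∼ β` on continuous homomorphisms of pseudocompact algebras:
`(α - β)(A) ⊆ J(B)` and `(α - β)(J(A)) ⊆ J²(B)`. -/
def AlgClose {B : Type u} [Ring B] [Algebra k B] [TopologicalSpace B] (α β : A →A[k] B) : Prop :=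
  (∀ a : A, α a - β a ∈ J B 1) ∧ ∀ a ∈ J A 1, α a - β a ∈ J B 2

end Algebra

section TensorLemmas

variable {k : Type u} [Field k] {V W : Type u} [AddCommGroup V] [Module k V] [AddCommGroup W]
  [Module k W]

/-- Products of point-separating families of functionals separate the points of `V ⊗ W`. -/
theorem tensor_separated {X Y : Type*} (f : X → Module.Dual k V)
    (hf : ∀ v, (∀ x, f x v = 0) → v = 0) (g : Y → Module.Dual k W)
    (hg : ∀ w, (∀ y, g y w = 0) → w = 0) (t : V ⊗[k] W)
    (h : ∀ x y, dualDistrib k V W (f x ⊗ₜ g y) t = 0) : t = 0 := by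
  have h1 : ∀ y, TensorProduct.rid k V ((g y).lTensor V t) = 0 := by
    intro y
    apply hf
    intro x
    rw [← h x y]
    clear h
    induction t with
    | zero => simp
    | tmul v w => simp [mul_comm]
    | add a b ha hb => simp_all
  classical
  let b := Module.Basis.ofVectorSpace k V
  apply (TensorProduct.equivFinsuppOfBasisLeft b).injective
  rw [map_zero]
  ext i
  apply hg
  intro y
  have h2 : b.coord i (TensorProduct.rid k V ((g y).lTensor V t)) = 0 := by rw [h1]; simp
  rw [← h2]
  clear h h1 h2
  induction t with
  | zero => simp
  | tmul v w => simp [mul_comm]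
  | add a b ha hb => simp_all

theorem dual_separated (v : V) (h : ∀ f : Module.Dual k V, f v = 0) : v = 0 :=
  (Module.forall_dual_apply_eq_zero_iff k v).1 h

end TensorLemmas

section DualAlgebra

variable (k : Type u) [Field k] (C : Type u) [AddCommGroup C] [Module k C] [Coalgebra k C]

/-- The dual algebra `C* = Hom_k(C, k)` of a coalgebra, with the convolution product
`(f * g)(c) = ∑ f(c₁) g(c₂)` and unit `ε`. -/
def DualAlg : Type u := WithConv (C →ₗ[k] k)

instance : Ring (DualAlg k C) := inferInstanceAs (Ring (WithConv (C →ₗ[k] k)))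
instance : Algebra k (DualAlg k C) := inferInstanceAs (Algebra k (WithConv (C →ₗ[k] k)))

variable {k C} in
/-- A linear functional on `C`, as an element of `C*`. -/
def DualAlg.of (f : C →ₗ[k] k) : DualAlg k C := WithConv.toConv f

variable {k C} in
/-- Evaluation of an element of `C*`, as a linear functional on `C`. -/
def DualAlg.eval (f : DualAlg k C) : C →ₗ[k] k := WithConv.ofConv f

/-- The topology of pointwise convergence on `C*`, where `k` is discrete. -/
instance : TopologicalSpace (DualAlg k C) :=
  TopologicalSpace.induced (fun f c => f.eval c) (@Pi.topologicalSpace C (fun _ => k) fun _ => ⊥)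

end DualAlgebra

section ContDual

variable (k : Type u) [Field k] (A : Type u) [Ring A] [Algebra k A] [TopologicalSpace A]

/-- The subspace of the linear functionals `A → k` that are continuous for the discrete topology
on `k`. -/
def contDualSubmodule : Submodule k (Module.Dual k A) where
  carrier := {f | Continuous[_, ⊥] f}
  zero_mem' := by
    let _ : TopologicalSpace k := ⊥
    exact continuous_const
  add_mem' := by
    intro f g hf hg
    let _ : TopologicalSpace k := ⊥
    have : DiscreteTopology k := ⟨rfl⟩
    exact Continuous.add (M := k) hf hg
  smul_mem' := by
    intro c f hf
    let _ : TopologicalSpace k := ⊥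
    have : DiscreteTopology k := ⟨rfl⟩
    exact (continuous_of_discreteTopology (f := fun x : k => c * x)).comp hf

variable {k A}

theorem mem_contDual_iff [IsTopologicalRing A] {f : Module.Dual k A} :
    f ∈ contDualSubmodule k A ↔ IsOpen (LinearMap.ker f : Set A) := by
  let _ : TopologicalSpace k := ⊥
  have : DiscreteTopology k := ⟨rfl⟩
  change Continuous f ↔ _
  constructor
  · intro h
    exact (isOpen_discrete ({0} : Set k)).preimage h
  · intro h
    refine continuous_of_continuousAt_zero f.toAddMonoidHom ?_
    rw [ContinuousAt, nhds_discrete k, Filter.tendsto_pure]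
    filter_upwards [h.mem_nhds (by simp)] with x hx
    simpa using hx

variable (k A) in
/-- The continuous dual `A*`: linear functionals `A → k`, continuous for the discrete topology
on `k`. -/
def ContDual : Type u := contDualSubmodule k A

instance : AddCommGroup (ContDual k A) := inferInstanceAs (AddCommGroup (contDualSubmodule k A))
instance : Module k (ContDual k A) := inferInstanceAs (Module k (contDualSubmodule k A))

variable (k) in
/-- Evaluation at `a : A`, as a functional on `A*`. -/
def ev (a : A) : Module.Dual k (ContDual k A) := (LinearMap.applyₗ a).comp (contDualSubmodule k A).subtype

@[simp]
theorem ev_apply (a : A) (f : ContDual k A) : ev k a f = f.1 a := rfl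

theorem ev_separated (f : ContDual k A) (h : ∀ a, ev k a f = 0) : f = 0 :=
  Subtype.ext (LinearMap.ext h)

variable (k A) in
/-- The pairing `A* ⊗ A* → (A × A → k)`, `⟨f ⊗ g, (a, b)⟩ = f(a) g(b)`. -/
def pairing : ContDual k A ⊗[k] ContDual k A →ₗ[k] (A → A → k) :=
  LinearMap.pi fun a => LinearMap.pi fun b => dualDistrib k _ _ (ev k a ⊗ₜ ev k b)

theorem pairing_apply (t : ContDual k A ⊗[k] ContDual k A) (a b : A) :
    pairing k A t a b = dualDistrib k _ _ (ev k a ⊗ₜ ev k b) t := rfl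

theorem pairing_injective : Function.Injective (pairing k A) := by
  rw [injective_iff_map_eq_zero]
  intro t ht
  refine tensor_separated (ev k) ev_separated (ev k) ev_separated t fun a b => ?_
  rw [← pairing_apply, ht]
  rfl

variable (k A) in
/-- The map dual to multiplication: `f ↦ ((a, b) ↦ f(ab))`. -/
def mulDual : ContDual k A →ₗ[k] (A → A → k) :=
  LinearMap.pi fun a => LinearMap.pi fun b => ev k (a * b)

theorem mulDual_mem_range [IsPseudocompact k A] (f : ContDual k A) :
    mulDual k A f ∈ LinearMap.range (pairing k A) := by
  obtain ⟨I, ⟨h2, ho, hfin⟩, hI⟩ := IsPseudocompact.exists_ideal_subset (k := k)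
    (LinearMap.ker f.1 : Set A) ((mem_contDual_iff.1 f.2).mem_nhds (by simp))
  let b := Module.finBasis k (A ⧸ I)
  let q : A →ₗ[k] A ⧸ I := (Submodule.mkQ I).restrictScalars k
  have hq : ∀ a, q a = 0 ↔ a ∈ I := fun a => Submodule.Quotient.mk_eq_zero I
  choose e he using fun i => Submodule.mkQ_surjective I (b i)
  have hφ : ∀ i, (b.coord i).comp q ∈ contDualSubmodule k A := by
    intro i
    rw [mem_contDual_iff]
    refine AddSubgroup.isOpen_mono (H₁ := I.toAddSubgroup)
      (H₂ := (LinearMap.ker ((b.coord i).comp q)).toAddSubgroup) ?_ ho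
    intro x hx
    have : q x = 0 := (hq x).2 hx
    simp [this]
  let φ : Fin (Module.finrank k (A ⧸ I)) → ContDual k A := fun i => ⟨(b.coord i).comp q, hφ i⟩
  have hdec : ∀ a, a - ∑ i, (φ i).1 a • e i ∈ I := by
    intro a
    rw [← hq, map_sub, map_sum, sub_eq_zero]
    conv_lhs => rw [← b.sum_repr (q a)]
    refine Finset.sum_congr rfl fun i _ => ?_
    rw [map_smul]
    congr 1
    exact (he i).symm
  have hf : ∀ x y, x - y ∈ I → f.1 x = f.1 y := by
    intro x y h
    have := hI h
    simpa [sub_eq_zero] using this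
  refine ⟨∑ i, ∑ j, f.1 (e i * e j) • (φ i ⊗ₜ φ j), ?_⟩
  ext x y
  have h1 : x * y - (∑ i, (φ i).1 x • e i) * (∑ j, (φ j).1 y • e j) ∈ I := by
    have : x * y - (∑ i, (φ i).1 x • e i) * (∑ j, (φ j).1 y • e j) =
      (x - ∑ i, (φ i).1 x • e i) * y +
        (∑ i, (φ i).1 x • e i) * (y - ∑ j, (φ j).1 y • e j) := by noncomm_ring
    rw [this]
    exact I.add_mem (I.mul_mem_right _ (hdec x)) (I.mul_mem_left _ (hdec y))
  change _ = f.1 (x * y)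
  rw [hf _ _ h1, Finset.sum_mul_sum, pairing_apply]
  simp only [map_sum, map_smul, dualDistrib_apply, ev_apply, smul_mul_smul_comm, smul_eq_mul]
  exact Finset.sum_congr rfl fun i _ => Finset.sum_congr rfl fun j _ => mul_comm _ _

variable (k A) in
/-- The comultiplication of `A*`: `Δ(f)` is the unique element of `A* ⊗ A*` such that
`⟨Δ(f), (a, b)⟩ = f(ab)` for all `a b : A`. -/
def contDualComul [IsPseudocompact k A] :
    ContDual k A →ₗ[k] ContDual k A ⊗[k] ContDual k A :=
  (LinearEquiv.ofInjective (pairing k A) pairing_injective).symm.toLinearMap.comp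
    ((mulDual k A).codRestrict _ mulDual_mem_range)

theorem contDualComul_spec [IsPseudocompact k A] (f : ContDual k A) (a b : A) :
    dualDistrib k _ _ (ev k a ⊗ₜ ev k b) (contDualComul k A f) = f.1 (a * b) := by
  have : pairing k A (contDualComul k A f) = mulDual k A f :=
    congrArg Subtype.val ((LinearEquiv.ofInjective (pairing k A) pairing_injective).apply_symm_apply
      ((mulDual k A).codRestrict _ mulDual_mem_range f))
  exact congrFun (congrFun this a) b

/-- The coalgebra structure on `A*` dual to the algebra structure of `A`: `Δ` is dual to the
multiplication and `ε(f) = f(1)`. -/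
instance [IsPseudocompact k A] : Coalgebra k (ContDual k A) where
  comul := contDualComul k A
  counit := ev k 1
  coassoc := by
    ext f : 1
    rw [← sub_eq_zero]
    refine tensor_separated (ev k) ev_separated
      (fun p : A × A => dualDistrib k _ _ (ev k p.1 ⊗ₜ ev k p.2))
      (fun w hw => tensor_separated (ev k) ev_separated (ev k) ev_separated w
        fun x y => hw (x, y)) _ ?_
    rintro a ⟨b, c⟩
    have h1 : ∀ t : ContDual k A ⊗[k] ContDual k A,
        dualDistrib k _ _ (ev k a ⊗ₜ dualDistrib k _ _ (ev k b ⊗ₜ ev k c))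
          (TensorProduct.assoc k _ _ _ ((contDualComul k A).rTensor _ t)) =
        dualDistrib k _ _ (ev k (a * b) ⊗ₜ ev k c) t := by
      intro t
      induction t with
      | zero => simp
      | add x y hx hy => simp only [map_add, hx, hy]
      | tmul f g =>
        rw [LinearMap.rTensor_tmul, dualDistrib_apply, ev_apply, ← contDualComul_spec]
        generalize contDualComul k A f = s
        induction s with
        | zero => simp
        | add x y hx hy => simp only [map_add, hx, hy, add_mul, TensorProduct.add_tmul]
        | tmul f' g' => simp [mul_assoc]
    have h2 : ∀ t : ContDual k A ⊗[k] ContDual k A,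
        dualDistrib k _ _ (ev k a ⊗ₜ dualDistrib k _ _ (ev k b ⊗ₜ ev k c))
          ((contDualComul k A).lTensor _ t) =
        dualDistrib k _ _ (ev k a ⊗ₜ ev k (b * c)) t := by
      intro t
      induction t with
      | zero => simp
      | add x y hx hy => simp only [map_add, hx, hy]
      | tmul f g => simp [contDualComul_spec]
    simp only [LinearMap.comp_apply, map_sub, LinearEquiv.coe_coe]
    rw [h1, h2, contDualComul_spec, contDualComul_spec, mul_assoc, sub_self]
  rTensor_counit_comp_comul := by
    ext f : 1
    apply (TensorProduct.lid k _).injective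
    refine Subtype.ext (LinearMap.ext fun a => ?_)
    have h : ∀ t : ContDual k A ⊗[k] ContDual k A,
        ev k a (TensorProduct.lid k _ ((ev k 1).rTensor _ t)) =
        dualDistrib k _ _ (ev k 1 ⊗ₜ ev k a) t := by
      intro t
      induction t with
      | zero => simp only [map_zero]
      | add x y hx hy => simp only [map_add, hx, hy]
      | tmul f g => simp
    refine (h _).trans ?_
    rw [contDualComul_spec]
    simp
  lTensor_counit_comp_comul := by
    ext f : 1
    apply (TensorProduct.rid k _).injective
    refine Subtype.ext (LinearMap.ext fun a => ?_)
    have h : ∀ t : ContDual k A ⊗[k] ContDual k A,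
        ev k a (TensorProduct.rid k _ ((ev k 1).lTensor _ t)) =
        dualDistrib k _ _ (ev k a ⊗ₜ ev k 1) t := by
      intro t
      induction t with
      | zero => simp only [map_zero]
      | add x y hx hy => simp only [map_add, hx, hy]
      | tmul f g => simp [mul_comm]
    refine (h _).trans ?_
    rw [contDualComul_spec]
    simp

/-- The coalgebra homomorphism `α* : B* → A*`, `f ↦ f ∘ α`, dual to `α : A → B`. -/
def contDualMap [IsPseudocompact k A] {B : Type u} [Ring B] [Algebra k B] [TopologicalSpace B]
    [IsPseudocompact k B] (α : A →A[k] B) : ContDual k B →ₗc[k] ContDual k A where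
  toFun f := ⟨f.1.comp α.toAlgHom.toLinearMap, by
    have hf : Continuous[_, ⊥] f.1 := f.2
    exact @Continuous.comp A B k _ _ ⊥ _ _ hf α.cont⟩
  map_add' _ _ := rfl
  map_smul' _ _ := rfl
  counit_comp := by
    ext f
    change f.1 (α 1) = f.1 1
    rw [map_one]
  map_comp_comul := by
    ext f : 1
    apply pairing_injective
    ext a b
    have h : ∀ (φ : ContDual k B →ₗ[k] ContDual k A) (_ : ∀ g x, (φ g).1 x = g.1 (α x))
        (t : ContDual k B ⊗[k] ContDual k B),
        pairing k A (TensorProduct.map φ φ t) a b = pairing k B t (α a) (α b) := by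
      intro φ hφ t
      induction t with
      | zero => simp
      | add x y hx hy => simp only [map_add, Pi.add_apply, hx, hy]
      | tmul f g => simp [pairing_apply, hφ]
    rw [LinearMap.comp_apply, h _ (fun _ _ => rfl)]
    refine (contDualComul_spec f (α a) (α b)).trans ?_
    rw [← map_mul]
    exact (contDualComul_spec (⟨f.1.comp α.toAlgHom.toLinearMap, _⟩ : ContDual k A) a b).symm

end ContDual

section DualAlgebra

variable {k : Type u} [Field k] {C : Type u} [AddCommGroup C] [Module k C] [Coalgebra k C]

theorem DualAlg.ext {f g : DualAlg k C} (h : ∀ c, f.eval c = g.eval c) : f = g :=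
  WithConv.ofConv_injective (LinearMap.ext h)

theorem DualAlg.eval_mul (f g : DualAlg k C) (c : C) :
    (f * g).eval c = dualDistrib k C C (f.eval ⊗ₜ g.eval) (Coalgebra.comul (R := k) c) := by
  change LinearMap.mul' k k (TensorProduct.map f.eval g.eval (Coalgebra.comul (R := k) c)) = _
  generalize Coalgebra.comul (R := k) c = t
  induction t with
  | zero => simp
  | add x y hx hy => simp only [map_add, hx, hy]
  | tmul x y => simp

theorem DualAlg.eval_one (c : C) : (1 : DualAlg k C).eval c = Coalgebra.counit (R := k) c := rfl

variable (k C) in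
/-- Evaluation as a linear map `C* → Hom_k(C, k)`. -/
def DualAlg.evalₗ : DualAlg k C →ₗ[k] Module.Dual k C where
  toFun f := f.eval
  map_add' _ _ := rfl
  map_smul' _ _ := rfl

theorem DualAlg.continuous_eval (c : C) :
    Continuous[_, ⊥] fun f : DualAlg k C => f.eval c := by
  let _ : TopologicalSpace k := ⊥
  exact (continuous_apply c).comp continuous_induced_dom

theorem DualAlg.continuous_iff {X : Type*} [TopologicalSpace X] {φ : X → DualAlg k C} :
    Continuous φ ↔ ∀ c, Continuous[_, ⊥] fun x => (φ x).eval c := by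
  let _ : TopologicalSpace k := ⊥
  exact continuous_induced_rng.trans continuous_pi_iff

theorem DualAlg.isOpen_eval_eq_zero (c : C) : IsOpen {f : DualAlg k C | f.eval c = 0} := by
  let _ : TopologicalSpace k := ⊥
  have : DiscreteTopology k := ⟨rfl⟩
  exact (isOpen_discrete ({0} : Set k)).preimage (DualAlg.continuous_eval c)

instance : IsTopologicalRing (DualAlg k C) := by
  let _ : TopologicalSpace k := ⊥
  have : DiscreteTopology k := ⟨rfl⟩
  have hc : ∀ c : C, Continuous fun f : DualAlg k C => f.eval c := DualAlg.continuous_eval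
  refine @IsTopologicalRing.mk _ _ _ (@IsTopologicalSemiring.mk _ _ _ ⟨?_⟩ ⟨?_⟩) ⟨?_⟩
  · rw [DualAlg.continuous_iff]
    intro c
    exact ((hc c).comp continuous_fst).add ((hc c).comp continuous_snd)
  · rw [DualAlg.continuous_iff]
    intro c
    simp only [DualAlg.eval_mul]
    generalize Coalgebra.comul (R := k) c = t
    induction t with
    | zero => simpa using continuous_const
    | add x y hx hy =>
      simp only [map_add]
      exact Continuous.add (M := k) hx hy
    | tmul x y =>
      simp only [dualDistrib_apply]
      exact ((hc x).comp continuous_fst).mul ((hc y).comp continuous_snd)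
  · rw [DualAlg.continuous_iff]
    intro c
    exact (hc c).neg

instance : T2Space (DualAlg k C) := by
  let _ : TopologicalSpace k := ⊥
  have : DiscreteTopology k := ⟨rfl⟩
  refine T2Space.of_injective_continuous (f := fun (f : DualAlg k C) (c : C) => f.eval c) ?_
    continuous_induced_dom
  intro f g h
  exact DualAlg.ext (congrFun h)

variable (k C) in
/-- The continuous algebra homomorphism `ρ* : D* → C*`, `f ↦ f ∘ ρ`, dual to `ρ : C → D`. -/
def dualAlgMap {D : Type u} [AddCommGroup D] [Module k D] [Coalgebra k D] (ρ : C →ₗc[k] D) :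
    DualAlg k D →A[k] DualAlg k C where
  toAlgHom := AlgHom.ofLinearMap
    { toFun := fun f => (WithConv.toConv (f.eval.comp ρ.toLinearMap) : WithConv (C →ₗ[k] k))
      map_add' := fun _ _ => rfl
      map_smul' := fun _ _ => rfl }
    (DualAlg.ext fun c => LinearMap.congr_fun ρ.counit_comp c)
    (fun f g => by
      apply WithConv.ofConv_injective
      exact LinearMap.convMul_comp_coalgHom_distrib (A := k) f g ρ)
  cont := by
    rw [DualAlg.continuous_iff]
    intro c
    exact DualAlg.continuous_eval (ρ c)

/-- Contraction of `C ⊗ C` by a functional on the left. -/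
def contrL (f : Module.Dual k C) : C ⊗[k] C →ₗ[k] C :=
  (TensorProduct.lid k C).toLinearMap.comp (f.rTensor C)

/-- Contraction of `C ⊗ C` by a functional on the right. -/
def contrR (f : Module.Dual k C) : C ⊗[k] C →ₗ[k] C :=
  (TensorProduct.rid k C).toLinearMap.comp (f.lTensor C)

theorem apply_contrL (f g : Module.Dual k C) (t : C ⊗[k] C) :
    g (contrL f t) = dualDistrib k C C (f ⊗ₜ g) t := by
  induction t with
  | zero => simp
  | add x y hx hy => simp only [map_add, hx, hy]
  | tmul x y => simp [contrL]

theorem apply_contrR (f g : Module.Dual k C) (t : C ⊗[k] C) :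
    g (contrR f t) = dualDistrib k C C (g ⊗ₜ f) t := by
  induction t with
  | zero => simp
  | add x y hx hy => simp only [map_add, hx, hy]
  | tmul x y => simp [contrR, mul_comm]

/-- A subspace stable under all contractions of `Δ` is a subcoalgebra. -/
theorem isSubcoalgebra_of_contr (D : Submodule k C)
    (hL : ∀ f, ∀ d ∈ D, contrL f (Coalgebra.comul (R := k) d) ∈ D)
    (hR : ∀ f, ∀ d ∈ D, contrR f (Coalgebra.comul (R := k) d) ∈ D) : IsSubcoalgebra k D := by
  intro d hd
  obtain ⟨p, hp⟩ := D.subtype.exists_leftInverse_of_injective D.ker_subtype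
  have hp' : ∀ x ∈ D, (p x : C) = x := fun x hx =>
    congrArg Subtype.val (LinearMap.congr_fun hp ⟨x, hx⟩)
  refine ⟨TensorProduct.map p p (Coalgebra.comul (R := k) d), ?_⟩
  rw [← sub_eq_zero]
  refine tensor_separated (fun f : Module.Dual k C => f) dual_separated
    (fun f : Module.Dual k C => f) dual_separated _ fun f g => ?_
  rw [map_sub, sub_eq_zero]
  have h1 : ∀ t : C ⊗[k] C, dualDistrib k C C (f ⊗ₜ g)
      (TensorProduct.map D.subtype D.subtype (TensorProduct.map p p t)) =
      dualDistrib k C C ((f.comp (D.subtype.comp p)) ⊗ₜ (g.comp (D.subtype.comp p))) t := by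
    intro t
    induction t with
    | zero => simp
    | add x y hx hy => simp only [map_add, hx, hy]
    | tmul x y => simp
  rw [h1, ← apply_contrL]
  change g (p (contrL _ _)) = _
  rw [hp' _ (hL _ _ hd), apply_contrL, ← apply_contrR]
  change f (p (contrR _ _)) = _
  rw [hp' _ (hR _ _ hd), apply_contrR]

theorem contrL_mul (f g : DualAlg k C) (c : C) :
    contrL g.eval (Coalgebra.comul (R := k) (contrL f.eval (Coalgebra.comul (R := k) c))) =
      contrL (f * g).eval (Coalgebra.comul (R := k) c) := by
  rw [← sub_eq_zero]
  refine dual_separated (k := k) _ fun h => ?_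
  rw [map_sub, sub_eq_zero, apply_contrL, apply_contrL]
  let h' : DualAlg k C := DualAlg.of h
  have e1 := DualAlg.eval_mul g h' (contrL f.eval (Coalgebra.comul (R := k) c))
  have e2 := DualAlg.eval_mul (f * g) h' c
  rw [apply_contrL, ← DualAlg.eval_mul, ← mul_assoc] at e1
  exact e1.symm.trans e2

theorem contrR_mul (f g : DualAlg k C) (c : C) :
    contrR g.eval (Coalgebra.comul (R := k) (contrR f.eval (Coalgebra.comul (R := k) c))) =
      contrR (g * f).eval (Coalgebra.comul (R := k) c) := by
  rw [← sub_eq_zero]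
  refine dual_separated (k := k) _ fun h => ?_
  rw [map_sub, sub_eq_zero, apply_contrR, apply_contrR]
  let h' : DualAlg k C := DualAlg.of h
  have e1 := DualAlg.eval_mul h' g (contrR f.eval (Coalgebra.comul (R := k) c))
  have e2 := DualAlg.eval_mul h' (g * f) c
  rw [apply_contrR, ← DualAlg.eval_mul, mul_assoc] at e1
  exact e1.symm.trans e2

theorem contrLR_comm (f g : DualAlg k C) (c : C) :
    contrL f.eval (Coalgebra.comul (R := k) (contrR g.eval (Coalgebra.comul (R := k) c))) =
      contrR g.eval (Coalgebra.comul (R := k) (contrL f.eval (Coalgebra.comul (R := k) c))) := by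
  rw [← sub_eq_zero]
  refine dual_separated (k := k) _ fun h => ?_
  rw [map_sub, sub_eq_zero, apply_contrL, apply_contrR]
  let h' : DualAlg k C := DualAlg.of h
  have e1 := DualAlg.eval_mul f h' (contrR g.eval (Coalgebra.comul (R := k) c))
  have e2 := DualAlg.eval_mul h' g (contrL f.eval (Coalgebra.comul (R := k) c))
  rw [apply_contrR, ← DualAlg.eval_mul] at e1
  rw [apply_contrL, ← DualAlg.eval_mul, ← mul_assoc] at e2
  exact e1.symm.trans e2

theorem contrL_fg (t : C ⊗[k] C) : ∃ V : Submodule k C, V.FG ∧ ∀ f, contrL f t ∈ V := by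
  induction t with
  | zero => exact ⟨⊥, Submodule.fg_bot, fun f => by simp⟩
  | add x y hx hy =>
    obtain ⟨V, hV, h1⟩ := hx
    obtain ⟨W, hW, h2⟩ := hy
    refine ⟨V ⊔ W, hV.sup hW, fun f => ?_⟩
    rw [map_add]
    exact Submodule.add_mem_sup (h1 f) (h2 f)
  | tmul x y =>
    refine ⟨Submodule.span k {y}, Submodule.fg_span_singleton y, fun f => ?_⟩
    have : contrL f (x ⊗ₜ y) = f x • y := by simp [contrL]
    rw [this]
    exact Submodule.smul_mem _ _ (Submodule.mem_span_singleton_self y)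

theorem contrR_fg (t : C ⊗[k] C) : ∃ V : Submodule k C, V.FG ∧ ∀ f, contrR f t ∈ V := by
  induction t with
  | zero => exact ⟨⊥, Submodule.fg_bot, fun f => by simp⟩
  | add x y hx hy =>
    obtain ⟨V, hV, h1⟩ := hx
    obtain ⟨W, hW, h2⟩ := hy
    refine ⟨V ⊔ W, hV.sup hW, fun f => ?_⟩
    rw [map_add]
    exact Submodule.add_mem_sup (h1 f) (h2 f)
  | tmul x y =>
    refine ⟨Submodule.span k {x}, Submodule.fg_span_singleton x, fun f => ?_⟩
    have : contrR f (x ⊗ₜ y) = f y • x := by simp [contrR]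
    rw [this]
    exact Submodule.smul_mem _ _ (Submodule.mem_span_singleton_self x)

theorem contrL_fg_of_fg (V : Submodule k C) (hV : V.FG) : ∃ W : Submodule k C, W.FG ∧
    ∀ v ∈ V, ∀ f, contrL f (Coalgebra.comul (R := k) v) ∈ W := by
  induction V, hV using Submodule.fg_induction with
  | singleton x =>
    obtain ⟨W, hW, h⟩ := contrL_fg (Coalgebra.comul (R := k) x)
    refine ⟨W, hW, fun v hv f => ?_⟩
    obtain ⟨a, rfl⟩ := Submodule.mem_span_singleton.1 hv
    rw [map_smul, map_smul]
    exact W.smul_mem _ (h f)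
  | sup V₁ V₂ hV₁ hV₂ h₁ h₂ =>
    obtain ⟨W₁, hW₁, h₁⟩ := h₁
    obtain ⟨W₂, hW₂, h₂⟩ := h₂
    refine ⟨W₁ ⊔ W₂, hW₁.sup hW₂, fun v hv f => ?_⟩
    obtain ⟨x, hx, y, hy, rfl⟩ := Submodule.mem_sup.1 hv
    rw [map_add, map_add]
    exact Submodule.add_mem_sup (h₁ x hx f) (h₂ y hy f)

theorem IsSubcoalgebra.sup {D E : Submodule k C} (hD : IsSubcoalgebra k D)
    (hE : IsSubcoalgebra k E) : IsSubcoalgebra k (D ⊔ E) := by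
  have key : ∀ F : Submodule k C, F ≤ D ⊔ E → IsSubcoalgebra k F → ∀ x ∈ F,
      Coalgebra.comul (R := k) x ∈
        LinearMap.range (TensorProduct.map (D ⊔ E).subtype (D ⊔ E).subtype) := by
    intro F hF hc x hx
    obtain ⟨t, ht⟩ := hc x hx
    refine ⟨TensorProduct.map (Submodule.inclusion hF) (Submodule.inclusion hF) t, ?_⟩
    rw [← ht, ← LinearMap.comp_apply, ← TensorProduct.map_comp]
    rfl
  intro v hv
  obtain ⟨x, hx, y, hy, rfl⟩ := Submodule.mem_sup.1 hv
  rw [map_add]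
  exact add_mem (key D le_sup_left hD x hx) (key E le_sup_right hE y hy)

/-- Every finite-dimensional subspace of a coalgebra lies in a finite-dimensional subcoalgebra. -/
theorem exists_fg_subcoalgebra (V : Submodule k C) (hV : V.FG) :
    ∃ D : Submodule k C, V ≤ D ∧ D.FG ∧ IsSubcoalgebra k D := by
  induction V, hV using Submodule.fg_induction with
  | sup V₁ V₂ hV₁ hV₂ h₁ h₂ =>
    obtain ⟨D₁, hle₁, hD₁, h₁⟩ := h₁
    obtain ⟨D₂, hle₂, hD₂, h₂⟩ := h₂
    exact ⟨D₁ ⊔ D₂, sup_le_sup hle₁ hle₂, hD₁.sup hD₂, h₁.sup h₂⟩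
  | singleton c =>
    let S : Set C := {x | ∃ f g : DualAlg k C, x = contrL f.eval (Coalgebra.comul (R := k)
      (contrR g.eval (Coalgebra.comul (R := k) c)))}
    have hone : ∀ x : C, contrL (1 : DualAlg k C).eval (Coalgebra.comul (R := k) x) = x := by
      intro x
      change TensorProduct.lid k C ((Coalgebra.counit (R := k)).rTensor C _) = x
      rw [Coalgebra.rTensor_counit_comul, TensorProduct.lid_tmul, one_smul]
    have hone' : ∀ x : C, contrR (1 : DualAlg k C).eval (Coalgebra.comul (R := k) x) = x := by
      intro x
      change TensorProduct.rid k C ((Coalgebra.counit (R := k)).lTensor C _) = x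
      rw [Coalgebra.lTensor_counit_comul, TensorProduct.rid_tmul, one_smul]
    refine ⟨Submodule.span k S, ?_, ?_, isSubcoalgebra_of_contr _ ?_ ?_⟩
    · rw [Submodule.span_singleton_le_iff_mem]
      exact Submodule.subset_span ⟨1, 1, by rw [hone', hone]⟩
    · obtain ⟨V, hV, h1⟩ := contrR_fg (Coalgebra.comul (R := k) c)
      obtain ⟨W, hW, h2⟩ := contrL_fg_of_fg V hV
      have : Module.Finite k W := Module.Finite.iff_fg.2 hW
      have hle : Submodule.span k S ≤ W := by
        rw [Submodule.span_le]
        rintro _ ⟨f, g, rfl⟩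
        exact h2 _ (h1 _) _
      exact Module.Finite.iff_fg.1 (Submodule.finiteDimensional_of_le hle)
    · intro f d hd
      refine Submodule.span_induction (p := fun d _ => contrL f (Coalgebra.comul (R := k) d) ∈
        Submodule.span k S) ?_ ?_ ?_ ?_ hd
      · rintro _ ⟨g, h, rfl⟩
        refine Submodule.subset_span ⟨g * DualAlg.of f, h, ?_⟩
        rw [← contrL_mul]
        rfl
      · simp
      · intro x y _ _ hx hy
        rw [map_add, map_add]
        exact add_mem hx hy
      · intro a x _ hx
        rw [map_smul, map_smul]
        exact Submodule.smul_mem _ _ hx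
    · intro f d hd
      refine Submodule.span_induction (p := fun d _ => contrR f (Coalgebra.comul (R := k) d) ∈
        Submodule.span k S) ?_ ?_ ?_ ?_ hd
      · rintro _ ⟨g, h, rfl⟩
        refine Submodule.subset_span ⟨g, DualAlg.of f * h, ?_⟩
        rw [← contrR_mul]
        exact (contrLR_comm g (DualAlg.of f) _).symm
      · simp
      · intro x y _ _ hx hy
        rw [map_add, map_add]
        exact add_mem hx hy
      · intro a x _ hx
        rw [map_smul, map_smul]
        exact Submodule.smul_mem _ _ hx

theorem mul_eval_eq_zero {D : Submodule k C} (hD : IsSubcoalgebra k D) (f g : DualAlg k C)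
    (h : (∀ d ∈ D, f.eval d = 0) ∨ ∀ d ∈ D, g.eval d = 0) (d : C) (hd : d ∈ D) :
    (f * g).eval d = 0 := by
  rw [DualAlg.eval_mul]
  obtain ⟨t, ht⟩ := hD d hd
  rw [← ht]
  clear ht
  induction t with
  | zero => simp
  | add x y hx hy => simp only [map_add, hx, hy, add_zero]
  | tmul x y =>
    rcases h with h | h
    · simp [h x x.2]
    · simp [h y y.2]

/-- The annihilator of a subcoalgebra of `C`, as an ideal of `C*`. -/
def annihIdeal {D : Submodule k C} (hD : IsSubcoalgebra k D) : Ideal (DualAlg k C) where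
  carrier := {f | ∀ d ∈ D, f.eval d = 0}
  zero_mem' _ _ := rfl
  add_mem' := by
    intro f g hf hg d hd
    change f.eval d + g.eval d = 0
    rw [hf d hd, hg d hd, add_zero]
  smul_mem' f g hg := mul_eval_eq_zero hD f g (Or.inr hg)

theorem isOpenCofinite_annihIdeal {D : Submodule k C} (hD : IsSubcoalgebra k D) (hfg : D.FG) :
    IsOpenCofinite k (annihIdeal hD) := by
  refine ⟨⟨fun g hf => mul_eval_eq_zero hD _ g (Or.inl hf)⟩, ?_, ?_⟩
  · obtain ⟨s, rfl⟩ := hfg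
    have : (annihIdeal hD : Set (DualAlg k C)) =
        ⋂ c ∈ s, {f : DualAlg k C | f.eval c = 0} := by
      ext f
      simp only [Set.mem_iInter]
      constructor
      · intro h c hc
        exact h c (Submodule.subset_span hc)
      · intro h d hd
        have : Submodule.span k (s : Set C) ≤ LinearMap.ker f.eval :=
          Submodule.span_le.2 fun c hc => h c hc
        exact this hd
    rw [this]
    exact isOpen_biInter_finset fun c _ => DualAlg.isOpen_eval_eq_zero c
  · have : Module.Finite k D := Module.Finite.iff_fg.2 hfg
    let φ : DualAlg k C →ₗ[k] Module.Dual k D :=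
      (Module.Dual.transpose (R := k) D.subtype).comp (DualAlg.evalₗ k C)
    have hker : LinearMap.ker φ = (annihIdeal hD).restrictScalars k := by
      ext f
      constructor
      · intro h d hd
        exact LinearMap.congr_fun h ⟨d, hd⟩
      · intro h
        exact LinearMap.ext fun d => h d.1 d.2
    have e : (DualAlg k C ⧸ (annihIdeal hD).restrictScalars k) →ₗ[k] Module.Dual k D :=
      Submodule.liftQ _ φ hker.ge
    have he : Function.Injective (Submodule.liftQ _ φ hker.ge) := by
      rw [← LinearMap.ker_eq_bot]
      exact Submodule.ker_liftQ_eq_bot _ _ _ hker.le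
    have := Module.Finite.of_injective _ he
    exact Module.Finite.equiv (Submodule.Quotient.restrictScalarsEquiv k (annihIdeal hD))

theorem exists_annihIdeal_subset (U : Set (DualAlg k C)) (hU : U ∈ 𝓝 0) :
    ∃ (D : Submodule k C) (hD : IsSubcoalgebra k D), D.FG ∧
      (annihIdeal hD : Set (DualAlg k C)) ⊆ U := by
  let _ : TopologicalSpace k := ⊥
  rw [mem_nhds_iff] at hU
  obtain ⟨V, hVU, hV, h0⟩ := hU
  obtain ⟨V', hV', rfl⟩ := isOpen_induced_iff.1 hV
  obtain ⟨I, u, hu, hI⟩ := isOpen_pi_iff.1 hV' _ h0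
  obtain ⟨D, hle, hfg, hD⟩ := exists_fg_subcoalgebra (Submodule.span k (I : Set C))
    ⟨I, rfl⟩
  refine ⟨D, hD, hfg, fun f hf => hVU (hI ?_)⟩
  intro c hc
  have h1 : f.eval c = 0 := hf c (hle (Submodule.subset_span hc))
  have h2 := (hu c hc).2
  change f.eval c ∈ u c
  rw [h1]
  exact h2

/-- The dual algebra of a coalgebra is pseudocompact. -/
instance : IsPseudocompact k (DualAlg k C) where
  exists_ideal_subset U hU := by
    obtain ⟨D, hD, hfg, h⟩ := exists_annihIdeal_subset U hU
    exact ⟨annihIdeal hD, isOpenCofinite_annihIdeal hD hfg, h⟩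
  complete x hx := by
    have hmono : ∀ (D E : Submodule k C) (hD : IsSubcoalgebra k D) (hE : IsSubcoalgebra k E)
        (_ : D.FG) (_ : E.FG) (_ : D ≤ E), ∀ c ∈ D,
        (x (annihIdeal hE)).eval c = (x (annihIdeal hD)).eval c := by
      intro D E hD hE hfD hfE hle c hc
      have := hx (annihIdeal hE) (annihIdeal hD) (isOpenCofinite_annihIdeal hE hfE)
        (isOpenCofinite_annihIdeal hD hfD) (fun f hf d hd => hf d (hle hd)) c hc
      exact sub_eq_zero.1 this
    have huniq : ∀ (D E : Submodule k C) (hD : IsSubcoalgebra k D) (hE : IsSubcoalgebra k E)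
        (_ : D.FG) (_ : E.FG), ∀ c ∈ D, c ∈ E →
        (x (annihIdeal hE)).eval c = (x (annihIdeal hD)).eval c := by
      intro D E hD hE hfD hfE c hc hc'
      rw [← hmono D (D ⊔ E) hD (hD.sup hE) hfD (hfD.sup hfE) le_sup_left c hc,
        ← hmono E (D ⊔ E) hE (hD.sup hE) hfE (hfD.sup hfE) le_sup_right c hc']
    choose D hle hfg hD using fun c : C => exists_fg_subcoalgebra (Submodule.span k {c})
      (Submodule.fg_span_singleton c)
    have hmem : ∀ c, c ∈ D c := fun c => hle c (Submodule.mem_span_singleton_self c)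
    let a : C → k := fun c => (x (annihIdeal (hD c))).eval c
    have ha : ∀ (E : Submodule k C) (hE : IsSubcoalgebra k E) (_ : E.FG), ∀ c ∈ E,
        a c = (x (annihIdeal hE)).eval c := fun E hE hfE c hc =>
      huniq E (D c) hE (hD c) hfE (hfg c) c hc (hmem c)
    let f : C →ₗ[k] k :=
      { toFun := a
        map_add' := by
          intro c d
          have hE := (hD c).sup (hD d)
          have hfE := (hfg c).sup (hfg d)
          have hc : c ∈ D c ⊔ D d := Submodule.mem_sup_left (hmem c)
          have hd : d ∈ D c ⊔ D d := Submodule.mem_sup_right (hmem d)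
          rw [ha _ hE hfE _ hc, ha _ hE hfE _ hd, ha _ hE hfE _ (add_mem hc hd), map_add]
        map_smul' := by
          intro r c
          rw [ha _ (hD c) (hfg c) c (hmem c),
            ha _ (hD c) (hfg c) _ (Submodule.smul_mem _ r (hmem c)), map_smul]
          rfl }
    refine ⟨DualAlg.of f, fun I hI => ?_⟩
    obtain ⟨E, hE, hfE, hEI⟩ := exists_annihIdeal_subset (I : Set (DualAlg k C))
      (hI.2.1.mem_nhds I.zero_mem)
    have h1 := hx (annihIdeal hE) I (isOpenCofinite_annihIdeal hE hfE) hI hEI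
    have h2 : DualAlg.of f - x (annihIdeal hE) ∈ I := by
      refine hEI fun c hc => ?_
      exact sub_eq_zero.2 (ha E hE hfE c hc)
    have h3 := I.add_mem h2 h1
    rwa [sub_add_sub_cancel] at h3

end DualAlgebra

section Categories

variable (k : Type u) [Field k]

/-- The category `Alg` of pseudocompact `k`-algebras and continuous homomorphisms. -/
structure PCAlg where
  carrier : Type u
  [ring : Ring carrier]
  [algebra : Algebra k carrier]
  [topology : TopologicalSpace carrier]
  [isPseudocompact : IsPseudocompact k carrier]

attribute [instance] PCAlg.ring PCAlg.algebra PCAlg.topology PCAlg.isPseudocompact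

instance : Category (PCAlg k) where
  Hom A B := A.carrier →A[k] B.carrier
  id A := ContinuousAlgHom.id k A.carrier
  comp f g := g.comp f

/-- The functor `(-)* : Cogᵒᵖ ⥤ Alg` from coalgebras to pseudocompact algebras. -/
def dualAlgFunctor : (CoalgCat.{u} k)ᵒᵖ ⥤ PCAlg k where
  obj C := { carrier := DualAlg k C.unop }
  map ρ := dualAlgMap k _ ρ.unop.toCoalgHom
  map_id _ := rfl
  map_comp _ _ := rfl

/-- The functor `(-)* : Algᵒᵖ ⥤ Cog` from pseudocompact algebras to coalgebras. -/
def dualCogFunctor : (PCAlg k)ᵒᵖ ⥤ CoalgCat.{u} k where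
  obj A := CoalgCat.of k (ContDual k A.unop.carrier)
  map α := CoalgCat.ofHom (contDualMap α.unop)
  map_id _ := rfl
  map_comp _ _ := rfl

/-- Pointed coalgebras, as a property of objects of `Cog`. -/
def pointedCog : ObjectProperty (CoalgCat.{u} k) := fun C => IsPointedCoalgebra k C

/-- Pointed pseudocompact algebras, as a property of objects of `Alg`. -/
def pointedAlg : ObjectProperty (PCAlg k) := fun A => IsPointedAlgebra k A.carrier

/-- The category of pointed coalgebras, a full subcategory of `Cog`. -/
abbrev PCog := (pointedCog k).FullSubcategory

/-- The category of pointed pseudocompact algebras, a full subcategory of `Alg`. -/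
abbrev PAlg := (pointedAlg k).FullSubcategory

/-- The relation `∼` on the morphisms of `PCog`. -/
def simCog : HomRel (PCog k) := fun _ _ ρ γ => CoalgClose ρ.hom.toCoalgHom γ.hom.toCoalgHom

/-- The relation `∼` on the morphisms of `PAlg`. -/
def simAlg : HomRel (PAlg k) := fun A B α β =>
  AlgClose (A := A.obj.carrier) (B := B.obj.carrier) α.hom β.hom

/-- The quotient category of `PCog` by `∼`. -/
abbrev PCogSim := CategoryTheory.Quotient (simCog k)

/-- The quotient category of `PAlg` by `∼`. -/
abbrev PAlgSim := CategoryTheory.Quotient (simAlg k)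

variable {k}

/-- The restriction `(-)* : PCogᵒᵖ ⥤ PAlg` of the duality functor to pointed objects. -/
def pointedDualAlg (h : ∀ C : CoalgCat.{u} k, pointedCog k C →
      pointedAlg k ((dualAlgFunctor k).obj (Opposite.op C))) : (PCog k)ᵒᵖ ⥤ PAlg k :=
  (pointedAlg k).lift ((pointedCog k).ι.op ⋙ dualAlgFunctor k)
    fun C => h C.unop.obj C.unop.property

/-- The restriction `(-)* : PAlgᵒᵖ ⥤ PCog` of the duality functor to pointed objects. -/
def pointedDualCog (h : ∀ A : PCAlg k, pointedAlg k A →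
      pointedCog k ((dualCogFunctor k).obj (Opposite.op A))) : (PAlg k)ᵒᵖ ⥤ PCog k :=
  (pointedCog k).lift ((pointedAlg k).ι.op ⋙ dualCogFunctor k)
    fun A => h A.unop.obj A.unop.property

end Categories

end PointedDuality

end

open PointedDuality

noncomputable section

namespace PointedDuality

/-! ### The actions of `C*` on `C`, and subcomodules, subcoalgebras and `C₁` in terms of them. -/

section Hit

variable {k : Type u} [Field k] {C : Type u} [AddCommGroup C] [Module k C] [Coalgebra k C]

/-! The proof rests on annihilators. Functionals separate points from subspaces, and a closed left
ideal of `C*` is recovered from its annihilator in `C` (`annih_perp`), so left subcomodules of `C`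
correspond, with the order reversed, to closed left ideals of `C*`. Maximal closed left ideals are
then the annihilators of the simple left subcomodules. It follows that J(C*) = C₀^⊥, and that J²(C*)
is the annihilator of C₀ together with all left subcomodules minimal over C₀.

For pointed `C` the latter sum is C₁ (`le_coradFil_one_of_covers`,
`IsPointedCoalgebra.coradFil_one_le`): C₀ is spanned by group-like elements, and an element of C₁
splits modulo C₀ into eigenvectors for the right action of `C*`. So J²(C*) = C₁^⊥. Since (ρ* -
γ*)(f) = f ∘ (ρ - γ), the two clauses of ρ* ∼ γ* turn into those of ρ ∼ γ by taking annihilators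
again (`algClose_dualAlgMap_iff`).

The evaluation maps C → C** and A → A** are isomorphisms (`toBidual_bijective`, `bidualAlgEquiv`).
This gives the duality, and it reduces every claim about an algebra `A` to the dual algebra of the
coalgebra `A*`: pointedness, the equivalence α ∼ β ↔ α* ∼ β*, and the congruence property on `PAlg`.
On `PCog` the congruence property holds because homomorphisms preserve group-like elements, hence C₀
and C₁ of pointed coalgebras. The passage to the quotient categories is formal. -/

/-- The right action of `C*` on `C`: `c ↼ f = ∑ f(c₁) c₂`. -/
def rightHit (f : DualAlg k C) : C →ₗ[k] C :=
  (contrL f.eval).comp (Coalgebra.comul (R := k))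

/-- The left action of `C*` on `C`: `g ⇀ c = ∑ c₁ g(c₂)`. -/
def leftHit (g : DualAlg k C) : C →ₗ[k] C :=
  (contrR g.eval).comp (Coalgebra.comul (R := k))

theorem eval_rightHit (f g : DualAlg k C) (c : C) :
    g.eval (rightHit f c) = (f * g).eval c := by
  rw [DualAlg.eval_mul]
  exact apply_contrL _ _ _

theorem eval_leftHit (f g : DualAlg k C) (c : C) :
    f.eval (leftHit g c) = (f * g).eval c := by
  rw [DualAlg.eval_mul]
  exact apply_contrR _ _ _

/-- Identities between the two actions are tested against functionals, where they become identities
of products in `C*`. Coassociativity is thus only ever used as `mul_assoc`. -/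
theorem eq_of_eval_eq {x y : C} (h : ∀ f : DualAlg k C, f.eval x = f.eval y) : x = y := by
  rw [← sub_eq_zero]
  refine dual_separated (k := k) _ fun f => ?_
  rw [map_sub, sub_eq_zero]
  exact h (DualAlg.of f)

theorem rightHit_mul (f g : DualAlg k C) (c : C) :
    rightHit (f * g) c = rightHit g (rightHit f c) :=
  eq_of_eval_eq (k := k) fun h => by simp only [eval_rightHit, mul_assoc]

theorem leftHit_mul (f g : DualAlg k C) (c : C) :
    leftHit (f * g) c = leftHit f (leftHit g c) :=
  eq_of_eval_eq (k := k) fun h => by simp only [eval_leftHit, mul_assoc]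

theorem rightHit_leftHit (f g : DualAlg k C) (c : C) :
    rightHit f (leftHit g c) = leftHit g (rightHit f c) :=
  eq_of_eval_eq (k := k) fun h => by simp only [eval_leftHit, eval_rightHit, mul_assoc]

theorem rightHit_one (c : C) : rightHit (1 : DualAlg k C) c = c :=
  eq_of_eval_eq (k := k) fun h => by rw [eval_rightHit, one_mul]

theorem leftHit_one (c : C) : leftHit (1 : DualAlg k C) c = c :=
  eq_of_eval_eq (k := k) fun h => by rw [eval_leftHit, mul_one]

theorem counit_rightHit (f : DualAlg k C) (c : C) :
    Coalgebra.counit (R := k) (rightHit f c) = f.eval c := by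
  rw [← DualAlg.eval_one, eval_rightHit, mul_one]

theorem rightHit_add_left (f g : DualAlg k C) (c : C) :
    rightHit (f + g) c = rightHit f c + rightHit g c :=
  eq_of_eval_eq (k := k) fun h => by
    rw [eval_rightHit, map_add, eval_rightHit, eval_rightHit, add_mul]
    rfl

/-- A tensor lies in `C ⊗ V` as soon as all its left contractions lie in `V`. -/
theorem mem_range_lTensor_iff (V : Submodule k C) (t : C ⊗[k] C) :
    t ∈ LinearMap.range (V.subtype.lTensor C) ↔ ∀ f : Module.Dual k C, contrL f t ∈ V := by
  constructor
  · rintro ⟨s, rfl⟩ f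
    induction s with
    | zero => simp
    | add x y hx hy => simpa only [map_add] using add_mem hx hy
    | tmul x y => simpa [contrL] using V.smul_mem _ y.2
  · intro h
    obtain ⟨p, hp⟩ := V.subtype.exists_leftInverse_of_injective V.ker_subtype
    have hp' : ∀ x ∈ V, (p x : C) = x := fun x hx =>
      congrArg Subtype.val (LinearMap.congr_fun hp ⟨x, hx⟩)
    refine ⟨p.lTensor C t, ?_⟩
    rw [← sub_eq_zero]
    refine tensor_separated (fun f : Module.Dual k C => f) dual_separated
      (fun f : Module.Dual k C => f) dual_separated _ fun f g => ?_
    have h1 : ∀ t : C ⊗[k] C, dualDistrib k C C (f ⊗ₜ g) (V.subtype.lTensor C (p.lTensor C t)) =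
        g (p (contrL f t)) := by
      intro t
      induction t with
      | zero => simp
      | add x y hx hy => simp only [map_add, hx, hy, Submodule.coe_add]
      | tmul x y => simp [contrL]
    rw [map_sub, sub_eq_zero, h1, hp' _ (h f), apply_contrL]

/-- A tensor lies in `C ⊗ V + W ⊗ C` if and only if it is killed by `W^⊥ ⊗ V^⊥`. -/
theorem mem_range_lTensor_sup_rTensor_iff (V W : Submodule k C) (t : C ⊗[k] C) :
    t ∈ LinearMap.range (V.subtype.lTensor C) ⊔ LinearMap.range (W.subtype.rTensor C) ↔
      ∀ f : Module.Dual k C, (∀ w ∈ W, f w = 0) → contrL f t ∈ V := by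
  constructor
  · intro h f hf
    obtain ⟨x, hx, y, ⟨s, rfl⟩, rfl⟩ := Submodule.mem_sup.1 h
    rw [map_add]
    refine add_mem ((mem_range_lTensor_iff V x).1 hx f) ?_
    have : contrL f (W.subtype.rTensor C s) = 0 := by
      clear h
      induction s with
      | zero => simp
      | add x y hx hy => simp only [map_add, hx, hy, add_zero]
      | tmul x y => simp [contrL, hf x x.2]
    rw [this]
    exact V.zero_mem
  · intro h
    obtain ⟨p, hp⟩ := W.subtype.exists_leftInverse_of_injective W.ker_subtype
    have hp' : ∀ x ∈ W, (p x : C) = x := fun x hx =>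
      congrArg Subtype.val (LinearMap.congr_fun hp ⟨x, hx⟩)
    -- `p` retracts `C` onto `W`. Contracting the first summand by `f` amounts to contracting `t` by
    -- f - f ∘ p, which vanishes on `W`, so the hypothesis applies to it.
    have ht : t = (t - W.subtype.rTensor C (p.rTensor C t)) + W.subtype.rTensor C (p.rTensor C t) :=
      (sub_add_cancel _ _).symm
    rw [ht]
    refine Submodule.add_mem_sup ?_ ⟨_, rfl⟩
    rw [mem_range_lTensor_iff]
    intro f
    have h1 : contrL f (t - W.subtype.rTensor C (p.rTensor C t)) =
        contrL (f - f.comp (W.subtype.comp p)) t := by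
      clear h ht
      induction t with
      | zero => simp
      | add x y hx hy =>
        rw [map_add (contrL _), ← hx, ← hy]
        simp only [map_add, map_sub]
        abel
      | tmul x y => simp [contrL]
    rw [h1]
    refine h _ fun w hw => ?_
    simp [hp' w hw]

theorem isLeftSubcomodule_iff {V : Submodule k C} :
    IsLeftSubcomodule k V ↔ ∀ f : DualAlg k C, ∀ v ∈ V, rightHit f v ∈ V := by
  constructor
  · intro h f v hv
    exact (mem_range_lTensor_iff V _).1 (h v hv) f.eval
  · intro h v hv
    exact (mem_range_lTensor_iff V _).2 fun f => h (DualAlg.of f) v hv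

theorem isSubcoalgebra_iff {D : Submodule k C} :
    IsSubcoalgebra k D ↔ (∀ f : DualAlg k C, ∀ d ∈ D, rightHit f d ∈ D) ∧
      ∀ f : DualAlg k C, ∀ d ∈ D, leftHit f d ∈ D := by
  constructor
  · intro h
    constructor
    · intro f d hd
      obtain ⟨s, hs⟩ := h d hd
      change contrL f.eval (Coalgebra.comul (R := k) d) ∈ D
      rw [← hs]
      clear hs
      induction s with
      | zero => simp
      | add x y hx hy => simpa only [map_add] using add_mem hx hy
      | tmul x y => simpa [contrL] using D.smul_mem _ y.2
    · intro f d hd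
      obtain ⟨s, hs⟩ := h d hd
      change contrR f.eval (Coalgebra.comul (R := k) d) ∈ D
      rw [← hs]
      clear hs
      induction s with
      | zero => simp
      | add x y hx hy => simpa only [map_add] using add_mem hx hy
      | tmul x y => simpa [contrR] using D.smul_mem _ x.2
  · rintro ⟨h1, h2⟩
    exact isSubcoalgebra_of_contr D (fun f => h1 (DualAlg.of f)) fun f => h2 (DualAlg.of f)

theorem IsSubcoalgebra.isLeftSubcomodule {D : Submodule k C} (hD : IsSubcoalgebra k D) :
    IsLeftSubcomodule k D :=
  isLeftSubcomodule_iff.2 (isSubcoalgebra_iff.1 hD).1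

theorem isLeftSubcomodule_bot : IsLeftSubcomodule k (⊥ : Submodule k C) :=
  isLeftSubcomodule_iff.2 fun f v hv => by simp [(Submodule.mem_bot k).1 hv]

theorem IsLeftSubcomodule.inf {V W : Submodule k C} (hV : IsLeftSubcomodule k V)
    (hW : IsLeftSubcomodule k W) : IsLeftSubcomodule k (V ⊓ W) := by
  rw [isLeftSubcomodule_iff] at *
  exact fun f v hv => ⟨hV f v hv.1, hW f v hv.2⟩

theorem isLeftSubcomodule_sSup {S : Set (Submodule k C)} (h : ∀ V ∈ S, IsLeftSubcomodule k V) :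
    IsLeftSubcomodule k (sSup S) := by
  rw [isLeftSubcomodule_iff]
  intro f v hv
  have : sSup S ≤ (sSup S).comap (rightHit f) := sSup_le fun V hV x hx =>
    (le_sSup hV : V ≤ sSup S) (isLeftSubcomodule_iff.1 (h V hV) f x hx)
  exact this hv

theorem isLeftSubcomodule_coradical : IsLeftSubcomodule k (coradical k C) :=
  isLeftSubcomodule_sSup fun _ hV => hV.1.1

/-- The functionals `f` are those of C₀^⊥, which `J_one_eq` identifies with J(C*). So C₁ consists of
the elements that J(C*) moves into C₀. -/
theorem mem_coradFil_one_iff {c : C} :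
    c ∈ coradFil k C 1 ↔ ∀ f : DualAlg k C, (∀ w ∈ coradical k C, f.eval w = 0) →
      rightHit f c ∈ coradical k C :=
  (mem_range_lTensor_sup_rTensor_iff _ _ _).trans
    ⟨fun h f hf => h f.eval hf, fun h f hf => h (DualAlg.of f) hf⟩

end Hit

/-! ### Closed left ideals of `C*` as annihilators, and the radicals of `C*`. -/

section Galois

variable {k : Type u} [Field k] {C : Type u} [AddCommGroup C] [Module k C] [Coalgebra k C]

/-- The annihilator in `C*` of a left subcomodule of `C`, as a left ideal. -/
def annih {V : Submodule k C} (hV : IsLeftSubcomodule k V) : Ideal (DualAlg k C) where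
  carrier := {f | ∀ c ∈ V, f.eval c = 0}
  zero_mem' _ _ := rfl
  add_mem' := by
    intro f g hf hg c hc
    change f.eval c + g.eval c = 0
    rw [hf c hc, hg c hc, add_zero]
  smul_mem' := by
    intro f g hg c hc
    rw [smul_eq_mul, ← eval_rightHit]
    exact hg _ (isLeftSubcomodule_iff.1 hV f c hc)

variable (k) in
/-- The subspace of `C` annihilated by a left ideal of `C*`. -/
def perp (L : Ideal (DualAlg k C)) : Submodule k C where
  carrier := {c | ∀ f ∈ L, f.eval c = 0}
  zero_mem' f _ := map_zero f.eval
  add_mem' := by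
    intro x y hx hy f hf
    rw [map_add, hx f hf, hy f hf, add_zero]
  smul_mem' := by
    intro a x hx f hf
    rw [map_smul, hx f hf, smul_zero]

theorem isLeftSubcomodule_perp (L : Ideal (DualAlg k C)) : IsLeftSubcomodule k (perp k L) := by
  rw [isLeftSubcomodule_iff]
  intro f c hc g hg
  rw [eval_rightHit]
  exact hc _ (L.mul_mem_left f hg)

theorem exists_eval_ne_zero {V : Submodule k C} {c : C} (hc : c ∉ V) :
    ∃ f : DualAlg k C, (∀ v ∈ V, f.eval v = 0) ∧ f.eval c ≠ 0 := by
  obtain ⟨f, hf, hV⟩ := Submodule.exists_le_ker_of_notMem hc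
  exact ⟨DualAlg.of f, fun v hv => hV hv, hf⟩

theorem mem_of_forall_eval {V : Submodule k C} {c : C}
    (h : ∀ f : DualAlg k C, (∀ v ∈ V, f.eval v = 0) → f.eval c = 0) : c ∈ V := by
  by_contra hc
  obtain ⟨f, hf, hfc⟩ := exists_eval_ne_zero hc
  exact hfc (h f hf)

theorem annih_le_annih_iff {V W : Submodule k C} {hV : IsLeftSubcomodule k V}
    {hW : IsLeftSubcomodule k W} : annih hV ≤ annih hW ↔ W ≤ V := by
  constructor
  · intro h c hc
    exact mem_of_forall_eval fun f hf => h hf c hc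
  · exact fun h f hf c hc => hf c (h hc)

theorem annih_lt_annih_iff {V W : Submodule k C} {hV : IsLeftSubcomodule k V}
    {hW : IsLeftSubcomodule k W} : annih hV < annih hW ↔ W < V := by
  rw [lt_iff_le_not_ge, lt_iff_le_not_ge, annih_le_annih_iff, annih_le_annih_iff]

theorem isClosed_annih {V : Submodule k C} (hV : IsLeftSubcomodule k V) :
    IsClosed (annih hV : Set (DualAlg k C)) := by
  let _ : TopologicalSpace k := ⊥
  have : DiscreteTopology k := ⟨rfl⟩
  have : (annih hV : Set (DualAlg k C)) = ⋂ c ∈ V, {f : DualAlg k C | f.eval c = 0} := by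
    ext f
    simp only [Set.mem_iInter]
    exact Iff.rfl
  rw [this]
  exact isClosed_biInter fun c _ =>
    (isClosed_discrete ({0} : Set k)).preimage (DualAlg.continuous_eval c)

/-- Every closed left ideal of `C*` is the annihilator of a left subcomodule of `C`. -/
theorem annih_perp {L : Ideal (DualAlg k C)} (hL : IsClosed (L : Set (DualAlg k C))) :
    annih (isLeftSubcomodule_perp L) = L := by
  refine le_antisymm (fun f hf => ?_) fun f hf c hc => hc f hf
  rw [← SetLike.mem_coe, ← hL.closure_eq, mem_closure_iff_nhds]
  intro U hU
  have hU0 : (fun g => f + g) ⁻¹' U ∈ 𝓝 (0 : DualAlg k C) := by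
    have : Continuous fun g : DualAlg k C => f + g := continuous_const.add continuous_id
    exact this.continuousAt.preimage_mem_nhds (by rwa [add_zero])
  -- The closure question becomes finite-dimensional: modulo D^⊥ it asks whether the restriction of
  -- `f` to `D` is the restriction of an element of `L`. Every subspace of the dual of `D` equals
  -- its double annihilator.
  obtain ⟨D, hD, hfg, hDU⟩ := exists_annihIdeal_subset _ hU0
  have : Module.Finite k D := Module.Finite.iff_fg.2 hfg
  let φ : DualAlg k C →ₗ[k] Module.Dual k D :=
    (Module.Dual.transpose (R := k) D.subtype).comp (DualAlg.evalₗ k C)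
  let W : Submodule k (Module.Dual k D) := (L.restrictScalars k).map φ
  have hW : φ f ∈ W := by
    rw [← Subspace.dualCoannihilator_dualAnnihilator_eq (W := W), Submodule.mem_dualAnnihilator]
    intro d hd
    rw [Submodule.mem_dualCoannihilator] at hd
    exact hf d.1 fun g hg => hd (φ g) ⟨g, hg, rfl⟩
  obtain ⟨g, hg, hgf⟩ := hW
  refine ⟨g, ?_, hg⟩
  have h1 : g - f ∈ annihIdeal hD := fun d hd => by
    have := LinearMap.congr_fun hgf ⟨d, hd⟩
    exact sub_eq_zero.2 this
  have h2 := hDU h1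
  simpa using h2

theorem annih_bot : annih (isLeftSubcomodule_bot (k := k) (C := C)) = ⊤ := by
  rw [eq_top_iff]
  intro f _ c hc
  rw [(Submodule.mem_bot k).1 hc, map_zero]

/-- `W` is minimal among the left subcomodules of `C` properly containing `V`. -/
def CoversSubcomodule (V W : Submodule k C) : Prop :=
  Minimal (fun W : Submodule k C => IsLeftSubcomodule k W ∧ V < W) W

/-- By `annih_perp` every closed left ideal competing with `annih hW` is itself an annihilator, so
order reversal exchanges maximality and minimality. -/
theorem isMaximalClosedIn_annih_iff {V W : Submodule k C} (hV : IsLeftSubcomodule k V)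
    (hW : IsLeftSubcomodule k W) :
    IsMaximalClosedIn (annih hV) (annih hW) ↔ CoversSubcomodule V W := by
  constructor
  · rintro ⟨⟨-, h1⟩, h2⟩
    refine ⟨⟨hW, annih_lt_annih_iff.1 h1⟩, ?_⟩
    rintro U ⟨hU, hVU⟩ hUW
    exact annih_le_annih_iff.1 (h2 (y := annih hU) ⟨isClosed_annih hU, annih_lt_annih_iff.2 hVU⟩
      (annih_le_annih_iff.2 hUW))
  · rintro ⟨⟨-, h1⟩, h2⟩
    refine ⟨⟨isClosed_annih hW, annih_lt_annih_iff.2 h1⟩, ?_⟩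
    rintro N ⟨hN, hNV⟩ hWN
    rw [← annih_perp hN] at hNV hWN ⊢
    exact annih_le_annih_iff.2 (h2 (y := perp k N) ⟨isLeftSubcomodule_perp N,
      annih_lt_annih_iff.1 hNV⟩
      (annih_le_annih_iff.1 hWN))

/-- An intersection of annihilators is the annihilator of the sum. The summand `V` matches the
factor `L ⊓` in `rad`, and it is what remains when nothing covers `V`. -/
theorem mem_rad_annih {V : Submodule k C} (hV : IsLeftSubcomodule k V) {f : DualAlg k C} :
    f ∈ rad (annih hV) ↔
      ∀ c ∈ V ⊔ sSup {W | CoversSubcomodule V W}, f.eval c = 0 := by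
  rw [rad, Ideal.mem_inf, Ideal.mem_sInf]
  constructor
  · rintro ⟨h1, h2⟩ c hc
    have : V ⊔ sSup {W | CoversSubcomodule V W} ≤ LinearMap.ker f.eval := by
      refine sup_le h1 (sSup_le fun W hW => ?_)
      exact fun c hc => h2 ((isMaximalClosedIn_annih_iff hV hW.1.1).2 hW) c hc
    exact this hc
  · intro h
    refine ⟨fun c hc => h c (Submodule.mem_sup_left hc), fun {N} hN => ?_⟩
    have hc := hN.1.1
    change IsMaximalClosedIn (annih hV) N at hN
    rw [← annih_perp hc, isMaximalClosedIn_annih_iff] at hN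
    rw [← annih_perp hc]
    exact fun c hc => h c (Submodule.mem_sup_right (le_sSup (a := perp k N) hN hc))

theorem coversSubcomodule_bot_iff {V : Submodule k C} :
    CoversSubcomodule ⊥ V ↔ IsSimpleLeftSubcomodule k V := by
  simp only [CoversSubcomodule, IsSimpleLeftSubcomodule, bot_lt_iff_ne_bot]

/-- `C*` is the annihilator of 0, and the left subcomodules covering 0 are the simple ones. -/
theorem J_one_eq : J (DualAlg k C) 1 = annih (isLeftSubcomodule_coradical (k := k) (C := C)) := by
  ext f
  change f ∈ rad ⊤ ↔ _
  rw [← annih_bot, mem_rad_annih, bot_sup_eq]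
  simp only [coversSubcomodule_bot_iff]
  rfl

theorem mem_J_one {f : DualAlg k C} :
    f ∈ J (DualAlg k C) 1 ↔ ∀ c ∈ coradFil k C 0, f.eval c = 0 := by
  rw [J_one_eq]
  rfl

/-- This holds over any coalgebra; for pointed ones the sum is identified with C₁ in
`IsPointedCoalgebra.mem_J_two`. -/
theorem mem_J_two {f : DualAlg k C} : f ∈ J (DualAlg k C) 2 ↔
    ∀ c ∈ coradical k C ⊔ sSup {W | CoversSubcomodule (coradical k C) W}, f.eval c = 0 := by
  change f ∈ rad (J _ 1) ↔ _
  rw [J_one_eq, mem_rad_annih]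

end Galois

/-! ### Group-like elements, the coradical of a pointed coalgebra, and the congruence on `PCog`. -/

section Pointed

variable {k : Type u} [Field k] {C : Type u} [AddCommGroup C] [Module k C] [Coalgebra k C]

theorem exists_minimal_le_of_fg {P : Submodule k C → Prop} {D : Submodule k C} (hD : D.FG)
    (hP : P D) : ∃ E ≤ D, Minimal P E := by
  obtain ⟨n, hn⟩ : ∃ n, Module.finrank k D = n := ⟨_, rfl⟩
  induction n using Nat.strong_induction_on generalizing D with
  | _ n ih =>
    by_cases h : Minimal P D
    · exact ⟨D, le_rfl, h⟩
    · rw [not_minimal_iff_exists_lt hP] at h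
      obtain ⟨E, hED, hE⟩ := h
      have : Module.Finite k D := Module.Finite.iff_fg.2 hD
      have hEf : E.FG := Module.Finite.iff_fg.1 (Submodule.finiteDimensional_of_le hED.le)
      obtain ⟨F, hFE, hF⟩ := ih _ (hn ▸ Submodule.finrank_lt_finrank_of_lt hED) hEf hE rfl
      exact ⟨F, hFE.trans hED.le, hF⟩

theorem IsSimpleLeftSubcomodule.eq_of_le {V W : Submodule k C} (hV : IsSimpleLeftSubcomodule k V)
    (hW : IsLeftSubcomodule k W) (h0 : W ≠ ⊥) (h : W ≤ V) : W = V :=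
  le_antisymm h (hV.2 (y := W) ⟨hW, h0⟩ h)

/-- A finite-dimensional subcoalgebra containing one nonzero vector of `V` meets `V` in a nonzero
subcomodule, hence contains `V`. -/
theorem exists_fg_subcoalgebra_of_simple {V : Submodule k C} (hV : IsSimpleLeftSubcomodule k V) :
    ∃ D : Submodule k C, V ≤ D ∧ D.FG ∧ IsSubcoalgebra k D := by
  obtain ⟨v, hv, hv0⟩ := Submodule.exists_mem_ne_zero_of_ne_bot hV.1.2
  obtain ⟨D, hle, hfg, hD⟩ := exists_fg_subcoalgebra (Submodule.span k {v})
    (Submodule.fg_span_singleton v)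
  have hvD : v ∈ D := hle (Submodule.mem_span_singleton_self v)
  refine ⟨D, ?_, hfg, hD⟩
  rw [← hV.eq_of_le (hV.1.1.inf hD.isLeftSubcomodule)
    (Submodule.ne_bot_iff _ |>.2 ⟨v, ⟨hv, hvD⟩, hv0⟩) inf_le_left]
  exact inf_le_right

theorem rightHit_of_isGroupLikeElem {g : C} (hg : IsGroupLikeElem k g) (f : DualAlg k C) :
    rightHit f g = f.eval g • g := by
  simp [rightHit, hg.comul_eq_tmul_self, contrL]

theorem leftHit_of_isGroupLikeElem {g : C} (hg : IsGroupLikeElem k g) (f : DualAlg k C) :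
    leftHit f g = f.eval g • g := by
  simp [leftHit, hg.comul_eq_tmul_self, contrR]

theorem isSubcoalgebra_span_groupLike {g : C} (hg : IsGroupLikeElem k g) :
    IsSubcoalgebra k (Submodule.span k {g}) := by
  rw [isSubcoalgebra_iff]
  constructor
  · intro f d hd
    obtain ⟨a, rfl⟩ := Submodule.mem_span_singleton.1 hd
    rw [map_smul, rightHit_of_isGroupLikeElem hg]
    exact Submodule.smul_mem _ _ (Submodule.smul_mem _ _ (Submodule.mem_span_singleton_self g))
  · intro f d hd
    obtain ⟨a, rfl⟩ := Submodule.mem_span_singleton.1 hd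
    rw [map_smul, leftHit_of_isGroupLikeElem hg]
    exact Submodule.smul_mem _ _ (Submodule.smul_mem _ _ (Submodule.mem_span_singleton_self g))

theorem isSimpleLeftSubcomodule_span_groupLike {g : C} (hg : IsGroupLikeElem k g) :
    IsSimpleLeftSubcomodule k (Submodule.span k {g}) := by
  refine ⟨⟨(isSubcoalgebra_span_groupLike hg).isLeftSubcomodule, ?_⟩, ?_⟩
  · rw [Ne, Submodule.span_singleton_eq_bot]
    exact hg.ne_zero
  · rintro W ⟨-, hW⟩ hle
    obtain ⟨w, hw, hw0⟩ := Submodule.exists_mem_ne_zero_of_ne_bot hW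
    obtain ⟨a, rfl⟩ := Submodule.mem_span_singleton.1 (hle hw)
    have ha : a ≠ 0 := fun h => hw0 (by rw [h, zero_smul])
    rw [Submodule.span_singleton_le_iff_mem]
    exact (W.smul_mem_iff ha).1 hw

/-- On a line spanned by `v` the algebra `C*` acts through a scalar function χ, and applying ε gives
f(v) = χ(f) ε(v). Hence ε(v) ≠ 0, and rescaling `v` so that ε takes the value 1 turns the
eigenvector equation into Δ(g) = g ⊗ g. -/
theorem exists_groupLike_of_finrank_eq_one {V : Submodule k C} (hV : IsLeftSubcomodule k V)
    (h1 : Module.finrank k V = 1) : ∃ g, IsGroupLikeElem k g ∧ V = Submodule.span k {g} := by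
  obtain ⟨⟨v, hv⟩, hv0, hspan⟩ := finrank_eq_one_iff'.1 h1
  have hv0' : v ≠ 0 := fun h => hv0 (Subtype.ext h)
  have hmul : ∀ w ∈ V, ∃ a : k, a • v = w := fun w hw => by
    obtain ⟨a, ha⟩ := hspan ⟨w, hw⟩
    exact ⟨a, congrArg Subtype.val ha⟩
  choose χ hχ using fun f : DualAlg k C => hmul _ (isLeftSubcomodule_iff.1 hV f v hv)
  have hf : ∀ f : DualAlg k C, f.eval v = χ f * Coalgebra.counit (R := k) v := fun f => by
    rw [← counit_rightHit, ← hχ, map_smul, smul_eq_mul]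
  have hε : Coalgebra.counit (R := k) v ≠ 0 := by
    intro h
    refine hv0' (dual_separated (k := k) v fun f => ?_)
    have := hf (DualAlg.of f)
    rw [h, mul_zero] at this
    exact this
  set e : k := Coalgebra.counit (R := k) v with he
  have hg : IsGroupLikeElem k (e⁻¹ • v) := by
    refine ⟨by rw [map_smul, smul_eq_mul, ← he, inv_mul_cancel₀ hε], ?_⟩
    rw [← sub_eq_zero]
    refine tensor_separated (fun f : Module.Dual k C => f) dual_separated
      (fun f : Module.Dual k C => f) dual_separated _ fun f h => ?_
    rw [map_sub, sub_eq_zero, ← apply_contrL, dualDistrib_apply]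
    change h (rightHit (DualAlg.of f) (e⁻¹ • v)) = f _ * _
    have hf' : f v = χ (DualAlg.of f) * e := hf (DualAlg.of f)
    rw [map_smul, ← hχ, map_smul, map_smul, map_smul, map_smul, hf']
    simp only [smul_eq_mul]
    field_simp
  refine ⟨_, hg, le_antisymm (fun w hw => ?_) ?_⟩
  · obtain ⟨a, rfl⟩ := hmul w hw
    refine Submodule.mem_span_singleton.2 ⟨a * e, ?_⟩
    rw [smul_smul, mul_assoc, mul_inv_cancel₀ hε, mul_one]
  · rw [Submodule.span_singleton_le_iff_mem]
    exact V.smul_mem _ hv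

/-- The subcoalgebra generated by a left subcomodule. -/
def coeffSubcoalgebra (V : Submodule k C) : Submodule k C :=
  ⨆ f : DualAlg k C, V.map (leftHit f)

theorem isSubcoalgebra_coeffSubcoalgebra {V : Submodule k C} (hV : IsLeftSubcomodule k V) :
    IsSubcoalgebra k (coeffSubcoalgebra V) := by
  rw [isSubcoalgebra_iff]
  constructor
  · intro f d hd
    have : coeffSubcoalgebra V ≤ (coeffSubcoalgebra V).comap (rightHit f) := by
      refine iSup_le fun g => ?_
      rintro _ ⟨v, hv, rfl⟩
      rw [Submodule.mem_comap, rightHit_leftHit]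
      exact Submodule.mem_iSup_of_mem g ⟨_, isLeftSubcomodule_iff.1 hV f v hv, rfl⟩
    exact this hd
  · intro f d hd
    have : coeffSubcoalgebra V ≤ (coeffSubcoalgebra V).comap (leftHit f) := by
      refine iSup_le fun g => ?_
      rintro _ ⟨v, hv, rfl⟩
      rw [Submodule.mem_comap, ← leftHit_mul]
      exact Submodule.mem_iSup_of_mem (f * g) ⟨v, hv, rfl⟩
    exact this hd

theorem le_coeffSubcoalgebra (V : Submodule k C) : V ≤ coeffSubcoalgebra V := fun v hv =>
  Submodule.mem_iSup_of_mem 1 ⟨v, hv, leftHit_one v⟩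

theorem coeffSubcoalgebra_le {V D : Submodule k C} (hD : IsSubcoalgebra k D) (h : V ≤ D) :
    coeffSubcoalgebra V ≤ D := by
  refine iSup_le fun g => ?_
  rintro _ ⟨v, hv, rfl⟩
  exact (isSubcoalgebra_iff.1 hD).2 g v (h hv)

/-- If the coefficient coalgebra of a simple left subcomodule `V` contains an eigenvector of weight
`g`, then so does `V`. -/
theorem exists_eigenvector_of_mem_iSup {V : Submodule k C} (hV : IsSimpleLeftSubcomodule k V)
    (g : C) (S : Finset (DualAlg k C)) (h : C) (h0 : h ≠ 0)
    (hh : ∀ f : DualAlg k C, rightHit f h = f.eval g • h)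
    (hS : h ∈ ⨆ f ∈ S, V.map (leftHit f)) :
    ∃ v ∈ V, v ≠ 0 ∧ ∀ f : DualAlg k C, rightHit f v = f.eval g • v := by
  classical
  induction S using Finset.induction_on generalizing h with
  | empty => simp at hS; exact absurd hS h0
  | insert l S _ ih =>
    rw [Finset.iSup_insert] at hS
    set U := ⨆ f ∈ S, V.map (leftHit f) with hU
    have hUr : ∀ f : DualAlg k C, U ≤ U.comap (rightHit f) := by
      intro f
      refine iSup₂_le fun m hm => ?_
      rintro _ ⟨v, hv, rfl⟩
      rw [Submodule.mem_comap, rightHit_leftHit]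
      exact Submodule.mem_iSup_of_mem m (Submodule.mem_iSup_of_mem hm
        ⟨_, isLeftSubcomodule_iff.1 hV.1.1 f v hv, rfl⟩)
    obtain ⟨_, ⟨v, hv, rfl⟩, y, hy, hsum⟩ := Submodule.mem_sup.1 hS
    have hK : IsLeftSubcomodule k (V ⊓ U.comap (leftHit l)) := by
      rw [isLeftSubcomodule_iff]
      rintro f x ⟨hx, hx'⟩
      refine ⟨isLeftSubcomodule_iff.1 hV.1.1 f x hx, ?_⟩
      change leftHit l (rightHit f x) ∈ U
      rw [← rightHit_leftHit]
      exact hUr f hx'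
    -- By simplicity there are two cases. Either `leftHit l` is injective on `V` modulo `U`, and the
    -- eigenvector equation of `h` lifts to `v` (if `v` = 0, then `h` already lies in `U`); or it
    -- maps all of `V` into `U`, and `l` can be dropped.
    by_cases hK0 : V ⊓ U.comap (leftHit l) = ⊥
    · by_cases hv0 : v = 0
      · refine ih h h0 hh ?_
        rw [← hsum, hv0, map_zero, zero_add]
        exact hy
      · refine ⟨v, hv, hv0, fun f => ?_⟩
        have : rightHit f v - f.eval g • v ∈ V ⊓ U.comap (leftHit l) := by
          refine ⟨V.sub_mem (isLeftSubcomodule_iff.1 hV.1.1 f v hv) (V.smul_mem _ hv), ?_⟩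
          have hvy : leftHit l v = h - y := eq_sub_of_add_eq hsum
          change leftHit l (rightHit f v - f.eval g • v) ∈ U
          rw [map_sub, map_smul, ← rightHit_leftHit, hvy, map_sub, hh, smul_sub,
            sub_sub_sub_cancel_left]
          exact U.sub_mem (U.smul_mem _ hy) (hUr f hy)
        rw [hK0] at this
        exact sub_eq_zero.1 ((Submodule.mem_bot k).1 this)
    · have := hV.eq_of_le hK hK0 inf_le_left
      refine ih h h0 hh ?_
      rw [← hsum]
      refine U.add_mem ?_ hy
      rw [← this] at hv
      exact hv.2

/-- Pointedness speaks of subcoalgebras, not of left subcomodules. The bridge is the coefficient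
coalgebra of `V`: it is finite-dimensional, so it contains a simple subcoalgebra, which is the line
of a group-like `g`. Then `V` has an eigenvector `v` of weight `g`, and v = ε(v) g forces `g` into
`V`. -/
theorem IsPointedCoalgebra.exists_groupLike (hC : IsPointedCoalgebra k C) {V : Submodule k C}
    (hV : IsSimpleLeftSubcomodule k V) :
    ∃ g, IsGroupLikeElem k g ∧ V = Submodule.span k {g} := by
  obtain ⟨D, hVD, hfg, hD⟩ := exists_fg_subcoalgebra_of_simple hV
  have : Module.Finite k D := Module.Finite.iff_fg.2 hfg
  have hfg' : (coeffSubcoalgebra V).FG := Module.Finite.iff_fg.1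
    (Submodule.finiteDimensional_of_le (coeffSubcoalgebra_le hD hVD))
  obtain ⟨E, hE, hEs⟩ := exists_minimal_le_of_fg
    (P := fun E : Submodule k C => IsSubcoalgebra k E ∧ E ≠ ⊥) hfg'
    ⟨isSubcoalgebra_coeffSubcoalgebra hV.1.1,
      fun h => hV.1.2 (le_bot_iff.1 (h ▸ le_coeffSubcoalgebra V))⟩
  obtain ⟨g, hg, rfl⟩ := exists_groupLike_of_finrank_eq_one hEs.1.1.isLeftSubcomodule (hC E hEs)
  obtain ⟨S, hS⟩ := Submodule.mem_iSup_iff_exists_finset.1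
    (hE (Submodule.mem_span_singleton_self g))
  obtain ⟨v, hv, hv0, hvf⟩ := exists_eigenvector_of_mem_iSup hV g S g hg.ne_zero
    (rightHit_of_isGroupLikeElem hg) hS
  have hvg : v = Coalgebra.counit (R := k) v • g := eq_of_eval_eq (k := k) fun f => by
    rw [← counit_rightHit, hvf, map_smul, map_smul, smul_eq_mul, smul_eq_mul, mul_comm]
  refine ⟨g, hg, (hV.eq_of_le hEs.1.1.isLeftSubcomodule hEs.1.2 ?_).symm⟩
  rw [Submodule.span_singleton_le_iff_mem]
  have hε : Coalgebra.counit (R := k) v ≠ 0 := fun h => hv0 (by rw [hvg, h, zero_smul])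
  rw [hvg] at hv
  exact (V.smul_mem_iff hε).1 hv

/-- A coalgebra is pointed if and only if its simple left subcomodules are one-dimensional. -/
theorem isPointedCoalgebra_iff : IsPointedCoalgebra k C ↔
    ∀ V : Submodule k C, IsSimpleLeftSubcomodule k V → Module.finrank k V = 1 := by
  constructor
  · intro hC V hV
    obtain ⟨g, hg, rfl⟩ := hC.exists_groupLike hV
    exact finrank_span_singleton hg.ne_zero
  · intro h D hD
    obtain ⟨d, hd, hd0⟩ := Submodule.exists_mem_ne_zero_of_ne_bot hD.1.2
    obtain ⟨F, hdF, hfg, hF⟩ := exists_fg_subcoalgebra (Submodule.span k {d})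
      (Submodule.fg_span_singleton d)
    have hdF' : d ∈ F := hdF (Submodule.mem_span_singleton_self d)
    have : Module.Finite k F := Module.Finite.iff_fg.2 hfg
    -- `D` is not known to be finite-dimensional; intersecting it with `F` makes a minimal left
    -- subcomodule available.
    obtain ⟨V, hVF, hV⟩ := exists_minimal_le_of_fg
      (P := fun E : Submodule k C => IsLeftSubcomodule k E ∧ E ≠ ⊥) (D := D ⊓ F)
      (Module.Finite.iff_fg.1 (Submodule.finiteDimensional_of_le inf_le_right))
      ⟨hD.1.1.isLeftSubcomodule.inf hF.isLeftSubcomodule,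
        (Submodule.ne_bot_iff _).2 ⟨d, ⟨hd, hdF'⟩, hd0⟩⟩
    obtain ⟨g, hg, rfl⟩ := exists_groupLike_of_finrank_eq_one hV.1.1 (h V hV)
    have hle : Submodule.span k {g} ≤ D := hVF.trans inf_le_left
    have : Submodule.span k {g} = D := le_antisymm hle
      (hD.2 (y := Submodule.span k {g}) ⟨isSubcoalgebra_span_groupLike hg, hV.1.2⟩ hle)
    rw [← this]
    exact finrank_span_singleton hg.ne_zero

theorem IsPointedCoalgebra.coradical_eq (hC : IsPointedCoalgebra k C) :
    coradical k C = Submodule.span k {g : C | IsGroupLikeElem k g} := by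
  refine le_antisymm (sSup_le fun V hV => ?_) (Submodule.span_le.2 fun g hg => ?_)
  · obtain ⟨g, hg, rfl⟩ := hC.exists_groupLike hV
    exact Submodule.span_mono (Set.singleton_subset_iff.2 hg)
  · exact le_sSup (a := Submodule.span k {g}) (isSimpleLeftSubcomodule_span_groupLike hg)
      (Submodule.mem_span_singleton_self g)

variable {D : Type u} [AddCommGroup D] [Module k D] [Coalgebra k D]

/-- Group-like elements go to group-like elements, and in a pointed source they span the coradical.
This is what makes ∼ compatible with composition. -/
theorem IsPointedCoalgebra.map_coradical (hC : IsPointedCoalgebra k C) (ρ : C →ₗc[k] D)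
    {c : C} (hc : c ∈ coradical k C) : ρ c ∈ coradical k D := by
  have : coradical k C ≤ (coradical k D).comap ρ.toLinearMap := by
    rw [hC.coradical_eq, Submodule.span_le]
    intro g hg
    exact le_sSup (a := Submodule.span k {ρ g}) (isSimpleLeftSubcomodule_span_groupLike
      (IsGroupLikeElem.map ρ hg)) (Submodule.mem_span_singleton_self _)
  exact this hc

theorem map_rightHit (ρ : C →ₗc[k] D) (f : DualAlg k D) (c : C) :
    ρ (rightHit (dualAlgMap k C ρ f) c) = rightHit f (ρ c) :=
  eq_of_eval_eq (k := k) fun h => by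
    rw [eval_rightHit]
    change (dualAlgMap k C ρ h).eval _ = (dualAlgMap k C ρ (f * h)).eval c
    rw [eval_rightHit, map_mul]

theorem IsPointedCoalgebra.map_coradFil_one (hC : IsPointedCoalgebra k C) (ρ : C →ₗc[k] D)
    {c : C} (hc : c ∈ coradFil k C 1) : ρ c ∈ coradFil k D 1 := by
  rw [mem_coradFil_one_iff] at hc ⊢
  intro f hf
  rw [← map_rightHit]
  exact hC.map_coradical ρ (hc _ fun w hw => hf _ (hC.map_coradical ρ hw))

theorem CoalgClose.comp_left {E : Type u} [AddCommGroup E] [Module k E] [Coalgebra k E]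
    (hC : IsPointedCoalgebra k C) (τ : C →ₗc[k] D) {ρ γ : D →ₗc[k] E} (h : CoalgClose ρ γ) :
    CoalgClose (ρ.comp τ) (γ.comp τ) :=
  ⟨fun _ hx => h.1 _ (hC.map_coradical τ hx), fun _ hx => h.2 _ (hC.map_coradFil_one τ hx)⟩

theorem CoalgClose.comp_right {E : Type u} [AddCommGroup E] [Module k E] [Coalgebra k E]
    (hD : IsPointedCoalgebra k D) {ρ γ : C →ₗc[k] D} (h : CoalgClose ρ γ) (σ : D →ₗc[k] E) :
    CoalgClose (σ.comp ρ) (σ.comp γ) := by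
  constructor
  · intro x hx
    change σ (ρ x) - σ (γ x) = 0
    rw [← map_sub, h.1 x hx, map_zero]
  · intro x hx
    change σ (ρ x) - σ (γ x) ∈ _
    rw [← map_sub]
    exact hD.map_coradical σ (h.2 x hx)

theorem coalgClose_equivalence : Equivalence (CoalgClose (k := k) (C := C) (D := D)) where
  refl ρ := ⟨fun x _ => sub_self _, fun x _ => by rw [sub_self]; exact zero_mem _⟩
  symm h := ⟨fun x hx => by rw [← neg_sub, h.1 x hx, neg_zero],
    fun x hx => by rw [← neg_sub]; exact neg_mem (h.2 x hx)⟩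
  trans h h' := ⟨fun x hx => by rw [← sub_add_sub_cancel, h.1 x hx, h'.1 x hx, add_zero],
    fun x hx => by rw [← sub_add_sub_cancel]; exact add_mem (h.2 x hx) (h'.2 x hx)⟩

end Pointed

/-! ### C₁ as the sum of the covers of C₀, and the comparison of ∼ for coalgebras and for dual
algebras. -/

section SecondSocle

variable {k : Type u} [Field k] {C : Type u} [AddCommGroup C] [Module k C] [Coalgebra k C]

/-- For `l` in C₀^⊥ the map `leftHit l` commutes with the right action and kills C₀, so the image of
`W` is a quotient of the simple W/C₀: it is zero or simple, and so lies in C₀. An `f` in C₀^⊥ kills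
this image, which says that `l` kills `rightHit f w`. As `l` varies, `rightHit f w` lies in C₀. -/
theorem le_coradFil_one_of_covers {W : Submodule k C}
    (hW : CoversSubcomodule (coradical k C) W) : W ≤ coradFil k C 1 := by
  intro w hw
  rw [mem_coradFil_one_iff]
  intro f hf
  refine mem_of_forall_eval (k := k) fun l hl => ?_
  rw [eval_rightHit, ← eval_leftHit]
  have hWs := isLeftSubcomodule_iff.1 hW.1.1
  have hker : ∀ x ∈ coradical k C, leftHit l x = 0 := fun x hx =>
    eq_of_eval_eq (k := k) fun h => by
      rw [eval_leftHit, ← eval_rightHit, map_zero]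
      exact hl _ (isLeftSubcomodule_iff.1 isLeftSubcomodule_coradical h x hx)
  have himg : ∀ U : Submodule k C, IsLeftSubcomodule k U →
      IsLeftSubcomodule k (U.map (leftHit l)) := by
    intro U hU
    rw [isLeftSubcomodule_iff]
    rintro h _ ⟨x, hx, rfl⟩
    rw [rightHit_leftHit]
    exact ⟨_, isLeftSubcomodule_iff.1 hU h x hx, rfl⟩
  by_cases h0 : W.map (leftHit l) = ⊥
  · have : leftHit l w ∈ W.map (leftHit l) := ⟨w, hw, rfl⟩
    rw [h0, Submodule.mem_bot] at this
    rw [this, map_zero]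
  · have hs : IsSimpleLeftSubcomodule k (W.map (leftHit l)) := by
      refine ⟨⟨himg W hW.1.1, h0⟩, ?_⟩
      rintro U ⟨hU, hU0⟩ hUW
      have hP : IsLeftSubcomodule k (W ⊓ U.comap (leftHit l)) := by
        rw [isLeftSubcomodule_iff]
        rintro h x ⟨hx, hx'⟩
        refine ⟨hWs h x hx, ?_⟩
        change leftHit l (rightHit h x) ∈ U
        rw [← rightHit_leftHit]
        exact isLeftSubcomodule_iff.1 hU h _ hx'
      have hle : coradical k C ≤ W ⊓ U.comap (leftHit l) := fun x hx =>
        ⟨hW.1.2.le hx, by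
          change leftHit l x ∈ U
          rw [hker x hx]
          exact zero_mem _⟩
      have hlt : coradical k C < W ⊓ U.comap (leftHit l) := by
        refine lt_of_le_of_ne hle fun heq => ?_
        obtain ⟨u, hu, hu0⟩ := Submodule.exists_mem_ne_zero_of_ne_bot hU0
        obtain ⟨x, hx, rfl⟩ := hUW hu
        have : x ∈ coradical k C := heq ▸ ⟨hx, hu⟩
        exact hu0 (hker x this)
      have := hW.2 (y := W ⊓ U.comap (leftHit l)) ⟨hP, hlt⟩ inf_le_left
      rintro _ ⟨x, hx, rfl⟩
      exact (this hx).2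
    exact hf _ ((le_sSup hs : W.map (leftHit l) ≤ coradical k C) ⟨w, hw, rfl⟩)

theorem coversSubcomodule_sup_span {V : Submodule k C} {x : C} (hx : x ∉ V)
    (h : IsLeftSubcomodule k (V ⊔ Submodule.span k {x})) :
    CoversSubcomodule V (V ⊔ Submodule.span k {x}) := by
  refine ⟨⟨h, lt_of_le_of_ne le_sup_left fun heq => hx ?_⟩, ?_⟩
  · rw [heq]
    exact Submodule.mem_sup_right (Submodule.mem_span_singleton_self x)
  · rintro U ⟨-, hVU⟩ hU
    refine sup_le hVU.le ?_
    rw [Submodule.span_singleton_le_iff_mem]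
    obtain ⟨u, hu, huV⟩ := SetLike.exists_of_lt hVU
    obtain ⟨v, hv, y, hy, rfl⟩ := Submodule.mem_sup.1 (hU hu)
    obtain ⟨a, rfl⟩ := Submodule.mem_span_singleton.1 hy
    have ha : a ≠ 0 := fun h => huV (by rw [h, zero_smul, add_zero]; exact hv)
    exact (U.smul_mem_iff ha).1 ((U.add_mem_iff_right (hVU.le hv)).1 hu)

/-- In a pointed coalgebra, an element of `C₁` is congruent modulo `C₀` to a finite sum of
elements that are eigenvectors modulo `C₀`. -/
theorem IsPointedCoalgebra.coradFil_one_le (hC : IsPointedCoalgebra k C) :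
    coradFil k C 1 ≤ coradical k C ⊔ sSup {W | CoversSubcomodule (coradical k C) W} := by
  classical
  intro c hc
  let G : Set C := {g : C | IsGroupLikeElem k g}
  have hli : LinearIndependent k (Subtype.val : G → C) := linearIndepOn_isGroupLikeElem
  -- Group-like elements are linearly independent, so their coordinate functionals extend to `C`.
  -- These extensions `δ g` act as orthogonal idempotents modulo functionals vanishing on C₀.
  obtain ⟨φ, hφ⟩ : ∃ φ : C →ₗ[k] (G →₀ k), ∀ g : G, φ g = Finsupp.single g 1 := by
    obtain ⟨φ, hφ⟩ := LinearMap.exists_leftInverse_of_injective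
      (Finsupp.linearCombination k (Subtype.val : G → C)) (LinearMap.ker_eq_bot.2 hli)
    refine ⟨φ, fun g => ?_⟩
    have := LinearMap.congr_fun hφ (Finsupp.single g 1)
    simpa using this
  let δ : G → DualAlg k C := fun g => DualAlg.of ((Finsupp.lapply g).comp φ)
  have hδ : ∀ g h : G, (δ g).eval h = if h = g then 1 else 0 := by
    intro g h
    change φ h g = _
    rw [hφ, Finsupp.single_apply]
  have hext : ∀ f : DualAlg k C, (∀ g : G, f.eval g = 0) → rightHit f c ∈ coradical k C := by
    intro f hf
    refine mem_coradFil_one_iff.1 hc f fun w hw => ?_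
    rw [hC.coradical_eq] at hw
    have : Submodule.span k G ≤ LinearMap.ker f.eval := Submodule.span_le.2 fun g hg => hf ⟨g, hg⟩
    exact this hw
  let π : C →ₗ[k] C := (Finsupp.linearCombination k (Subtype.val : G → C)).comp φ
  have hπ : ∀ g : G, π g = g := fun g => by simp [π, hφ]
  -- A tensor has finitely many left factors, and `π` sends each to a combination of finitely many
  -- group-likes. This makes the decomposition of `c` a finite sum even when there are infinitely
  -- many group-likes.
  have hfin : ∀ t : C ⊗[k] C, ∃ S : Finset G, ∀ f : Module.Dual k C, (∀ g ∈ S, f g = 0) →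
      contrL (f.comp π) t = 0 := by
    intro t
    induction t with
    | zero => exact ⟨∅, fun f _ => map_zero _⟩
    | add x y hx hy =>
      obtain ⟨S, hS⟩ := hx
      obtain ⟨T, hT⟩ := hy
      refine ⟨S ∪ T, fun f hf => ?_⟩
      rw [map_add, hS f fun g hg => hf g (Finset.mem_union_left _ hg),
        hT f fun g hg => hf g (Finset.mem_union_right _ hg), add_zero]
    | tmul x y =>
      refine ⟨(φ x).support, fun f hf => ?_⟩
      have : f (π x) = 0 := by
        change f (Finsupp.linearCombination k _ (φ x)) = 0
        rw [Finsupp.linearCombination_apply, Finsupp.sum, map_sum]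
        exact Finset.sum_eq_zero fun g hg => by rw [map_smul, hf g hg, smul_zero]
      simp [contrL, this]
  obtain ⟨S, hS⟩ := hfin (Coalgebra.comul (R := k) c)
  have hS' : ∀ f : DualAlg k C, (∀ g ∈ S, f.eval g = 0) → rightHit f c ∈ coradical k C := by
    intro f hf
    let f' : DualAlg k C := DualAlg.of (f.eval.comp π)
    have h1 : rightHit f' c = 0 := hS f.eval hf
    have h2 : rightHit (f - f') c ∈ coradical k C := hext _ fun g => by
      change f.eval g - f.eval (π g) = 0
      rw [hπ, sub_self]
    have h3 := rightHit_add_left (f - f') f' c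
    rw [sub_add_cancel, h1, add_zero] at h3
    rwa [h3]
  have hsum : ∀ T : Finset G, rightHit (∑ g ∈ T, δ g) c = ∑ g ∈ T, rightHit (δ g) c := by
    intro T
    induction T using Finset.induction_on with
    | empty => exact eq_of_eval_eq (k := k) fun h => by simp [eval_rightHit]; rfl
    | insert g T hg ih => rw [Finset.sum_insert hg, Finset.sum_insert hg, rightHit_add_left, ih]
  have heval : ∀ (T : Finset G) (x : C), (∑ g ∈ T, δ g).eval x = ∑ g ∈ T, (δ g).eval x := by
    intro T x
    change (DualAlg.evalₗ k C (∑ g ∈ T, δ g)) x = _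
    rw [map_sum, LinearMap.sum_apply]
    rfl
  have hone : rightHit (1 - ∑ g ∈ S, δ g) c ∈ coradical k C := by
    refine hS' _ fun g hg => ?_
    change (1 : DualAlg k C).eval (g : C) - (∑ g ∈ S, δ g).eval (g : C) = 0
    rw [heval, DualAlg.eval_one, g.2.counit_eq_one]
    simp [hδ, hg]
  have hdec : c = rightHit (1 - ∑ g ∈ S, δ g) c + ∑ g ∈ S, rightHit (δ g) c := by
    rw [← hsum, ← rightHit_add_left, sub_add_cancel, rightHit_one]
  rw [hdec]
  refine add_mem (Submodule.mem_sup_left hone) (Submodule.sum_mem _ fun g _ => ?_)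
  by_cases hg : rightHit (δ g) c ∈ coradical k C
  · exact Submodule.mem_sup_left hg
  refine Submodule.mem_sup_right (Submodule.mem_sSup_of_mem
    (coversSubcomodule_sup_span hg ?_)
    (Submodule.mem_sup_right (Submodule.mem_span_singleton_self _)))
  rw [isLeftSubcomodule_iff]
  intro h v hv
  obtain ⟨w, hw, y, hy, rfl⟩ := Submodule.mem_sup.1 hv
  obtain ⟨a, rfl⟩ := Submodule.mem_span_singleton.1 hy
  rw [map_add, map_smul]
  refine add_mem (Submodule.mem_sup_left
    (isLeftSubcomodule_iff.1 isLeftSubcomodule_coradical h w hw)) (Submodule.smul_mem _ _ ?_)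
  -- Functionals multiply pointwise on group-likes, so this one vanishes on all of them. Hence
  -- `rightHit (δ g) c` is an eigenvector of weight `g` modulo C₀, and adjoining it to C₀ gives a
  -- left subcomodule covering C₀.
  have h1 : rightHit (δ g * h - h.eval g • δ g) c ∈ coradical k C := by
    refine hext _ fun g' => ?_
    change (δ g * h).eval (g' : C) - h.eval g • (δ g).eval g' = 0
    rw [DualAlg.eval_mul, g'.2.comul_eq_tmul_self, dualDistrib_apply, hδ]
    split_ifs with hgg
    · rw [hgg, one_mul, smul_eq_mul, mul_one, sub_self]
    · rw [zero_mul, smul_zero, sub_zero]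
  have h2 := rightHit_add_left (δ g * h - h.eval g • δ g) (h.eval g • δ g) c
  rw [sub_add_cancel, rightHit_mul] at h2
  rw [h2]
  refine Submodule.add_mem_sup h1 (Submodule.mem_span_singleton.2 ⟨h.eval g, ?_⟩)
  refine eq_of_eval_eq (k := k) fun l => ?_
  rw [map_smul, eval_rightHit, eval_rightHit, smul_mul_assoc]
  rfl

theorem IsPointedCoalgebra.mem_J_two (hC : IsPointedCoalgebra k C) {f : DualAlg k C} :
    f ∈ J (DualAlg k C) 2 ↔ ∀ c ∈ coradFil k C 1, f.eval c = 0 := by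
  have h : coradFil k C 1 =
      coradical k C ⊔ sSup {W | CoversSubcomodule (coradical k C) W} := by
    refine le_antisymm hC.coradFil_one_le (sup_le (fun c hc => ?_) (sSup_le fun W hW =>
      le_coradFil_one_of_covers hW))
    exact mem_coradFil_one_iff.2 fun f _ =>
      isLeftSubcomodule_iff.1 isLeftSubcomodule_coradical f c hc
  rw [PointedDuality.mem_J_two, h]

variable {D : Type u} [AddCommGroup D] [Module k D] [Coalgebra k D]

/-- Passing to dual algebras preserves and reflects `∼`. -/
theorem algClose_dualAlgMap_iff (hC : IsPointedCoalgebra k C) (ρ γ : C →ₗc[k] D) :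
    AlgClose (dualAlgMap k C ρ) (dualAlgMap k C γ) ↔ CoalgClose ρ γ := by
  have he : ∀ (f : DualAlg k D) (c : C), (dualAlgMap k C ρ f - dualAlgMap k C γ f).eval c =
      f.eval (ρ c - γ c) := fun f c => (map_sub f.eval (ρ c) (γ c)).symm
  refine and_congr ?_ ?_
  · simp only [mem_J_one, he]
    constructor
    · exact fun h c hc => dual_separated (k := k) _ fun f => h (DualAlg.of f) c hc
    · exact fun h f c hc => by rw [h c hc, map_zero]
  · simp only [hC.mem_J_two, he]
    constructor
    -- Here `f` runs through J(D*) = D₀^⊥, whose common zeros are exactly D₀.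
    · exact fun h c hc => mem_of_forall_eval fun f hf => h f (mem_J_one.2 hf) c hc
    · exact fun h f hf c hc => mem_J_one.1 hf _ (h c hc)

theorem finrank_quotient_annih {V : Submodule k C} (hV : IsLeftSubcomodule k V) :
    Module.finrank k (DualAlg k C ⧸ annih hV) = Module.finrank k (Module.Dual k V) := by
  let φ : DualAlg k C →ₗ[k] Module.Dual k V :=
    (Module.Dual.transpose (R := k) V.subtype).comp (DualAlg.evalₗ k C)
  have hφ : Function.Surjective φ := fun f => by
    obtain ⟨g, hg⟩ := LinearMap.exists_extend f
    exact ⟨DualAlg.of g, hg⟩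
  have hker : (annih hV).restrictScalars k = LinearMap.ker φ := by
    ext f
    constructor
    · exact fun h => LinearMap.ext fun d => h d.1 d.2
    · exact fun h d hd => LinearMap.congr_fun h ⟨d, hd⟩
  exact ((Submodule.Quotient.restrictScalarsEquiv k (annih hV)).symm.trans
    ((Submodule.quotEquivOfEq _ _ hker).trans
      (φ.quotKerEquivOfSurjective hφ))).finrank_eq

/-- A coalgebra is pointed if and only if its dual algebra is pointed. -/
theorem isPointedAlgebra_dualAlg_iff :
    IsPointedAlgebra k (DualAlg k C) ↔ IsPointedCoalgebra k C := by
  have hfin : ∀ {V : Submodule k C} (hV : IsLeftSubcomodule k V),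
      Module.finrank k (DualAlg k C ⧸ annih hV) = Module.finrank k V := fun {V} hV => by
    -- For infinite-dimensional `V` both `finrank`s take the default value 0, so no finiteness is
    -- needed.
    rw [finrank_quotient_annih, Subspace.dual_finrank_eq]
  rw [isPointedCoalgebra_iff]
  constructor
  · intro h V hV
    rw [← hfin hV.1.1]
    refine h _ ?_
    rw [← annih_bot, isMaximalClosedIn_annih_iff, coversSubcomodule_bot_iff]
    exact hV
  · intro h M hM
    have hc := hM.1.1
    rw [← annih_perp hc] at hM ⊢
    rw [← annih_bot, isMaximalClosedIn_annih_iff, coversSubcomodule_bot_iff] at hM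
    rw [hfin]
    exact h _ hM

end SecondSocle

/-! ### The isomorphism C ≅ C**. -/

section CoalgebraBidual

variable {k : Type u} [Field k] {C : Type u} [AddCommGroup C] [Module k C] [Coalgebra k C]

/-- Evaluation at `c`, as a continuous linear functional on `C*`. -/
def evalAt (c : C) : ContDual k (DualAlg k C) :=
  ⟨(LinearMap.applyₗ c).comp (DualAlg.evalₗ k C), DualAlg.continuous_eval c⟩

variable (k C) in
/-- The canonical homomorphism `C → C**`. -/
def toBidual : C →ₗc[k] ContDual k (DualAlg k C) where
  toFun := evalAt
  map_add' x y := Subtype.ext (LinearMap.ext fun f => map_add f.eval x y)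
  map_smul' a x := Subtype.ext (LinearMap.ext fun f => map_smul f.eval a x)
  counit_comp := LinearMap.ext fun _ => rfl
  map_comp_comul := by
    ext c : 1
    apply pairing_injective
    ext f g
    have h : ∀ (φ : C →ₗ[k] ContDual k (DualAlg k C)) (_ : ∀ c, φ c = evalAt c) (t : C ⊗[k] C),
        pairing k _ (TensorProduct.map φ φ t) f g = dualDistrib k C C (f.eval ⊗ₜ g.eval) t := by
      intro φ hφ t
      induction t with
      | zero => simp
      | add x y hx hy => simp only [map_add, Pi.add_apply, hx, hy]
      | tmul x y =>
        rw [TensorProduct.map_tmul, hφ, hφ]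
        rfl
    rw [LinearMap.comp_apply, h _ (fun _ => rfl), ← DualAlg.eval_mul]
    exact (contDualComul_spec (evalAt c) f g).symm

/-- For surjectivity: a continuous functional on `C*` vanishes on the annihilator of some finite set
of elements of `C`, so it is a linear combination of the evaluations at them. -/
theorem toBidual_bijective : Function.Bijective (toBidual k C) := by
  constructor
  · intro x y h
    exact eq_of_eval_eq (k := k) fun f => LinearMap.congr_fun (congrArg Subtype.val h) f
  · intro φ
    obtain ⟨D, hD, ⟨s, hs⟩, hDφ⟩ := exists_annihIdeal_subset (LinearMap.ker φ.1 : Set (DualAlg k C))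
      ((mem_contDual_iff.1 φ.2).mem_nhds (by simp))
    have hspan := mem_span_of_iInf_ker_le_ker (ι := s) (L := fun c : s => (evalAt (k := k) c.1).1)
      (K := φ.1) (by
        intro f hf
        refine hDφ ?_
        have : D ≤ LinearMap.ker f.eval := by
          rw [← hs, Submodule.span_le]
          exact fun c hc => (Submodule.mem_iInf _).1 hf ⟨c, hc⟩
        exact this)
    have hle : Submodule.span k (Set.range fun c : s => (evalAt (k := k) c.1).1) ≤
        LinearMap.range ((contDualSubmodule k (DualAlg k C)).subtype.comp
          (toBidual k C).toLinearMap) := by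
      rw [Submodule.span_le]
      rintro _ ⟨c, rfl⟩
      exact ⟨c.1, rfl⟩
    obtain ⟨c, hc⟩ := hle hspan
    exact ⟨c, Subtype.ext hc⟩

variable (k C) in
/-- A coalgebra is canonically isomorphic to its bidual. -/
def bidualEquiv : C ≃ₗc[k] ContDual k (DualAlg k C) :=
  CoalgEquiv.ofBijective (f := toBidual k C) toBidual_bijective

end CoalgebraBidual

/-! ### The isomorphism A ≅ A** of topological algebras. -/

section AlgebraBidual

variable {k : Type u} [Field k] {A : Type u} [Ring A] [Algebra k A] [TopologicalSpace A]
  [IsPseudocompact k A]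

/-- The continuous functional on `A` induced by a functional on a discrete quotient. -/
def ContDual.ofQuotient {I : Ideal A} (hI : IsOpenCofinite k I) (g : Module.Dual k (A ⧸ I)) :
    ContDual k A :=
  ⟨g.comp ((Submodule.mkQ I).restrictScalars k), by
    rw [mem_contDual_iff]
    refine AddSubgroup.isOpen_mono (H₁ := I.toAddSubgroup)
      (H₂ := (LinearMap.ker (g.comp ((Submodule.mkQ I).restrictScalars k))).toAddSubgroup) ?_ hI.2.1
    intro x hx
    have : (Submodule.mkQ I).restrictScalars k x = 0 := (Submodule.Quotient.mk_eq_zero I).2 hx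
    change g ((Submodule.mkQ I).restrictScalars k x) = 0
    rw [this, map_zero]⟩

theorem ContDual.ofQuotient_apply {I : Ideal A} (hI : IsOpenCofinite k I)
    (g : Module.Dual k (A ⧸ I)) (a : A) :
    (ContDual.ofQuotient hI g).1 a = g (Submodule.Quotient.mk a) := rfl

theorem exists_isOpenCofinite_le_ker (f : ContDual k A) :
    ∃ I : Ideal A, IsOpenCofinite k I ∧ ∀ a ∈ I, f.1 a = 0 := by
  obtain ⟨I, hI, hIf⟩ := IsPseudocompact.exists_ideal_subset (k := k)
    (LinearMap.ker f.1 : Set A) ((mem_contDual_iff.1 f.2).mem_nhds (by simp))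
  exact ⟨I, hI, fun a ha => hIf ha⟩

theorem mem_of_forall_ofQuotient {I : Ideal A} (hI : IsOpenCofinite k I) {a : A}
    (h : ∀ g, (ContDual.ofQuotient hI g).1 a = 0) : a ∈ I :=
  (Submodule.Quotient.mk_eq_zero I).1 (dual_separated (k := k) _ h)

variable (k A) in
/-- The canonical homomorphism `A → A**`. -/
def toBidualAlg : A →A[k] DualAlg k (ContDual k A) where
  toAlgHom := AlgHom.ofLinearMap
    { toFun := fun a => DualAlg.of (ev k a)
      map_add' := fun a b => DualAlg.ext fun f => map_add f.1 a b
      map_smul' := fun r a => DualAlg.ext fun f => map_smul f.1 r a }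
    (DualAlg.ext fun _ => rfl)
    (fun a b => DualAlg.ext fun f => by
      rw [DualAlg.eval_mul]
      exact (contDualComul_spec f a b).symm)
  cont := by
    rw [DualAlg.continuous_iff]
    exact fun f => f.2

theorem toBidualAlg_eval (a : A) (f : ContDual k A) : (toBidualAlg k A a).eval f = f.1 a := rfl

/-- Injectivity is the Hausdorff property. For surjectivity, `φ` restricted to the dual of the
finite-dimensional A/I is evaluation at some `x I`. These elements are compatible, so completeness
yields a limit `a`, and evaluation at `a` is `φ` because each continuous functional factors through
some A/I. -/
theorem toBidualAlg_bijective : Function.Bijective (toBidualAlg k A) := by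
  constructor
  · rw [injective_iff_map_eq_zero]
    intro a ha
    by_contra h0
    obtain ⟨I, hI, hIU⟩ := IsPseudocompact.exists_ideal_subset (k := k) ({a}ᶜ : Set A)
      (isOpen_compl_singleton.mem_nhds fun h => h0 h.symm)
    refine hIU (mem_of_forall_ofQuotient hI fun g => ?_) rfl
    rw [← toBidualAlg_eval, ha]
    rfl
  · intro φ
    have hex : ∀ I : Ideal A, IsOpenCofinite k I → ∃ x : A, ∀ f : ContDual k A,
        (∀ a ∈ I, f.1 a = 0) → f.1 x = φ.eval f := by
      intro I hI
      have := hI.2.2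
      let r : Module.Dual k (A ⧸ I) →ₗ[k] ContDual k A :=
        { toFun := ContDual.ofQuotient hI
          map_add' := fun _ _ => rfl
          map_smul' := fun _ _ => rfl }
      obtain ⟨x, hx⟩ := Submodule.mkQ_surjective I
        ((Module.evalEquiv k (A ⧸ I)).symm (φ.eval.comp r))
      refine ⟨x, fun f hf => ?_⟩
      let g : Module.Dual k (A ⧸ I) :=
        (Submodule.liftQ (I.restrictScalars k) f.1 hf).comp
          (Submodule.Quotient.restrictScalarsEquiv k I).symm.toLinearMap
      have hg : r g = f := Subtype.ext (LinearMap.ext fun a => rfl)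
      rw [← hg]
      change g (Submodule.mkQ I x) = (φ.eval.comp r) g
      rw [hx, Module.apply_evalEquiv_symm_apply]
    choose! x hx using hex
    obtain ⟨a, ha⟩ := IsPseudocompact.complete (k := k) x (by
      intro I K hI hK hle
      refine mem_of_forall_ofQuotient hK fun g => ?_
      have h0 : ∀ a ∈ K, (ContDual.ofQuotient hK g).1 a = 0 := fun a ha => by
        rw [ContDual.ofQuotient_apply, (Submodule.Quotient.mk_eq_zero K).2 ha, map_zero]
      rw [map_sub, hx I hI _ fun a ha => h0 a (hle ha), hx K hK _ h0, sub_self])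
    refine ⟨a, DualAlg.ext fun f => ?_⟩
    obtain ⟨I, hI, hf⟩ := exists_isOpenCofinite_le_ker f
    rw [toBidualAlg_eval, ← hx I hI f hf, ← sub_eq_zero, ← map_sub]
    exact hf _ (ha I hI)

variable (k A) in
/-- A pseudocompact algebra is canonically isomorphic to its bidual. -/
def bidualAlgEquiv : A ≃A[k] DualAlg k (ContDual k A) where
  __ := AlgEquiv.ofBijective (toBidualAlg k A).toAlgHom toBidualAlg_bijective
  continuous_toFun := (toBidualAlg k A).cont
  continuous_invFun := by
    let e := AlgEquiv.ofBijective (toBidualAlg k A).toAlgHom toBidualAlg_bijective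
    refine continuous_of_continuousAt_zero e.symm ?_
    rw [ContinuousAt, map_zero]
    intro U hU
    obtain ⟨I, hI, hIU⟩ := IsPseudocompact.exists_ideal_subset (k := k) U hU
    have := hI.2.2
    let b := Module.finBasis k (A ⧸ I)
    -- `I` is the common kernel of the finitely many coordinate functionals of A/I, so its image in
    -- the bidual is cut out by finitely many open conditions.
    have hopen : IsOpen (⋂ i, {φ : DualAlg k (ContDual k A) |
        φ.eval (ContDual.ofQuotient hI (b.coord i)) = 0}) :=
      isOpen_iInter_of_finite fun i => DualAlg.isOpen_eval_eq_zero _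
    refine Filter.mem_map.2 (Filter.mem_of_superset (hopen.mem_nhds ?_) ?_)
    · simp only [Set.mem_iInter]
      exact fun i => rfl
    · intro φ hφ
      obtain ⟨a, rfl⟩ := e.surjective φ
      simp only [Set.mem_iInter] at hφ
      change e.symm (e a) ∈ U
      rw [AlgEquiv.symm_apply_apply]
      refine hIU ((Submodule.Quotient.mk_eq_zero I).1 (b.ext_elem fun i => ?_))
      rw [map_zero]
      exact hφ i

end AlgebraBidual

/-! ### Invariance of the radicals, pointedness and ∼ under isomorphisms of topological algebras. -/

section Transport

variable {k : Type u} [Field k] {A B : Type u} [Ring A] [Algebra k A] [TopologicalSpace A]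
  [Ring B] [Algebra k B] [TopologicalSpace B]

/-- The isomorphism between the lattices of left ideals induced by an isomorphism of algebras. -/
def idealIso (e : A ≃A[k] B) : Ideal B ≃o Ideal A :=
  RingEquiv.idealComapOrderIso (e.toAlgEquiv : A ≃+* B)

theorem mem_idealIso (e : A ≃A[k] B) {L : Ideal B} {a : A} : a ∈ idealIso e L ↔ e a ∈ L := Iff.rfl

theorem isClosed_idealIso_iff (e : A ≃A[k] B) {L : Ideal B} :
    IsClosed (idealIso e L : Set A) ↔ IsClosed (L : Set B) :=
  e.toHomeomorph.isClosed_preimage (s := (L : Set B))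

theorem isMaximalClosedIn_idealIso_iff (e : A ≃A[k] B) {L N : Ideal B} :
    IsMaximalClosedIn (idealIso e L) (idealIso e N) ↔ IsMaximalClosedIn L N := by
  have h : ∀ N : Ideal B, (IsClosed (idealIso e N : Set A) ∧ idealIso e N < idealIso e L) ↔
      (IsClosed (N : Set B) ∧ N < L) := fun N => by
    rw [isClosed_idealIso_iff, OrderIso.lt_iff_lt]
  constructor
  · rintro ⟨h1, h2⟩
    refine ⟨(h N).1 h1, fun M hM hNM => ?_⟩
    exact (idealIso e).le_iff_le.1 (h2 (y := idealIso e M) ((h M).2 hM)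
      ((idealIso e).le_iff_le.2 hNM))
  · rintro ⟨h1, h2⟩
    refine ⟨(h N).2 h1, fun M hM hNM => ?_⟩
    obtain ⟨M, rfl⟩ := (idealIso e).surjective M
    exact (idealIso e).le_iff_le.2 (h2 ((h M).1 hM) ((idealIso e).le_iff_le.1 hNM))

theorem rad_idealIso (e : A ≃A[k] B) (L : Ideal B) : rad (idealIso e L) = idealIso e (rad L) := by
  rw [rad, rad, map_inf]
  congr 1
  ext a
  rw [mem_idealIso, Ideal.mem_sInf, Ideal.mem_sInf]
  constructor
  · intro h N hN
    exact h (I := idealIso e N) ((isMaximalClosedIn_idealIso_iff e).2 hN)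
  · intro h N hN
    obtain ⟨N, rfl⟩ := (idealIso e).surjective N
    exact h ((isMaximalClosedIn_idealIso_iff e).1 hN)

theorem J_idealIso (e : A ≃A[k] B) (n : ℕ) : idealIso e (J B n) = J A n := by
  induction n with
  | zero => exact map_top _
  | succ n ih =>
    change idealIso e (rad (J B n)) = rad (J A n)
    rw [← rad_idealIso, ih]

theorem apply_mem_J_iff (e : A ≃A[k] B) (n : ℕ) {a : A} : e a ∈ J B n ↔ a ∈ J A n := by
  rw [← J_idealIso e, mem_idealIso]

theorem IsPointedAlgebra.of_equiv (e : A ≃A[k] B) (hA : IsPointedAlgebra k A) :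
    IsPointedAlgebra k B := by
  intro M hM
  have hM' : IsMaximalClosedIn ⊤ (idealIso e M) := by
    rw [← map_top (idealIso e), isMaximalClosedIn_idealIso_iff]
    exact hM
  rw [← hA _ hM']
  have hmap : (((idealIso e M).restrictScalars k).map (e.toAlgEquiv.toLinearEquiv : A →ₗ[k] B)) =
      M.restrictScalars k := by
    ext b
    constructor
    · rintro ⟨a, ha, rfl⟩
      exact ha
    · intro hb
      exact ⟨e.symm b, by
        change e (e.symm b) ∈ M
        rw [ContinuousAlgEquiv.apply_symm_apply]
        exact hb, e.apply_symm_apply b⟩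
  exact ((Submodule.Quotient.restrictScalarsEquiv k (idealIso e M)).symm.trans
    ((Submodule.Quotient.equiv _ _ e.toAlgEquiv.toLinearEquiv hmap).trans
      (Submodule.Quotient.restrictScalarsEquiv k M))).finrank_eq.symm

/-- It is applied with bidual isomorphisms for `e` and `e'`, so that α ∼ β can be compared with α**
∼ β**. -/
theorem algClose_iff_of_equiv {A' B' : Type u} [Ring A'] [Algebra k A'] [TopologicalSpace A']
    [Ring B'] [Algebra k B'] [TopologicalSpace B'] (e : A ≃A[k] A') (e' : B ≃A[k] B')
    {α β : A →A[k] B} {α' β' : A' →A[k] B'} (hα : ∀ a, α' (e a) = e' (α a))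
    (hβ : ∀ a, β' (e a) = e' (β a)) : AlgClose α' β' ↔ AlgClose α β := by
  have h : ∀ n a, α' (e a) - β' (e a) ∈ J B' n ↔ α a - β a ∈ J B n := fun n a => by
    rw [hα, hβ, ← map_sub, apply_mem_J_iff]
  refine and_congr ?_ ?_
  · rw [e.surjective.forall]
    simp only [h]
  · rw [e.surjective.forall]
    simp only [h, apply_mem_J_iff]

end Transport

/-! ### The duality, its compatibility with ∼, and the induced duality of quotient categories. -/

section Duality

variable (k : Type u) [Field k]

theorem pointedAlg_dual (C : CoalgCat.{u} k) (hC : pointedCog k C) :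
    pointedAlg k ((dualAlgFunctor k).obj (Opposite.op C)) :=
  isPointedAlgebra_dualAlg_iff.2 hC

theorem pointedCog_dual (A : PCAlg k) (hA : pointedAlg k A) :
    pointedCog k ((dualCogFunctor k).obj (Opposite.op A)) :=
  isPointedAlgebra_dualAlg_iff.1 (IsPointedAlgebra.of_equiv (bidualAlgEquiv k A.carrier) hA)

instance congruence_simCog : Congruence (simCog k) where
  equivalence := fun {C D} =>
    (coalgClose_equivalence (k := k) (C := C.obj) (D := D.obj)).comap
      fun f : C ⟶ D => f.hom.toCoalgHom
  comp_left {C _ _} τ _ _ h := CoalgClose.comp_left C.property τ.hom.toCoalgHom h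
  comp_right {_ D _} _ _ σ h := CoalgClose.comp_right D.property h σ.hom.toCoalgHom

/-- The functor `PCogᵒᵖ ⥤ PAlg`. -/
abbrev dualAlg : (PCog k)ᵒᵖ ⥤ PAlg k := pointedDualAlg (pointedAlg_dual k)

/-- The functor `PAlgᵒᵖ ⥤ PCog`. -/
abbrev dualCog : (PAlg k)ᵒᵖ ⥤ PCog k := pointedDualCog (pointedCog_dual k)

variable {k}

theorem simCog_iff {C D : PCog k} (ρ γ : C ⟶ D) :
    simCog k ρ γ ↔ simAlg k ((dualAlg k).map ρ.op) ((dualAlg k).map γ.op) :=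
  (algClose_dualAlgMap_iff C.property ρ.hom.toCoalgHom γ.hom.toCoalgHom).symm

/-- The criterion `simCog_iff` for α* and β* concerns α** and β**, which the bidual isomorphisms
turn back into α and β. The two `rfl` are the naturality of evaluation. -/
theorem simAlg_iff {A B : PAlg k} (α β : A ⟶ B) :
    simAlg k α β ↔ simCog k ((dualCog k).map α.op) ((dualCog k).map β.op) := by
  rw [simCog_iff]
  exact (algClose_iff_of_equiv (bidualAlgEquiv k A.obj.carrier) (bidualAlgEquiv k B.obj.carrier)
    (α := α.hom) (β := β.hom) (α' := ((dualAlg k).map ((dualCog k).map α.op).op).hom)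
    (β' := ((dualAlg k).map ((dualCog k).map β.op).op).hom) (fun _ => rfl) (fun _ => rfl)).symm

variable (k)

/-- The congruence is pulled back from `PCog` along the functor `(-)*`; contravariance exchanges
left and right composition. -/
instance congruence_simAlg : Congruence (simAlg k) where
  equivalence := fun {A B} =>
    { refl := fun α => (simAlg_iff α α).2 ((congruence_simCog k).equivalence.refl _)
      symm := fun h => (simAlg_iff _ _).2
        ((congruence_simCog k).equivalence.symm ((simAlg_iff _ _).1 h))
      trans := fun h h' => (simAlg_iff _ _).2 ((congruence_simCog k).equivalence.trans
        ((simAlg_iff _ _).1 h) ((simAlg_iff _ _).1 h')) }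
  comp_left f _ _ h := by
    rw [simAlg_iff] at h ⊢
    simp only [op_comp, Functor.map_comp]
    exact HomRel.comp_right _ h
  comp_right g h := by
    rw [simAlg_iff] at h ⊢
    simp only [op_comp, Functor.map_comp]
    exact HomRel.comp_left _ h

variable {k}

/-- A pointed coalgebra is isomorphic to its bidual. -/
def bidualIso (C : PCog k) :
    C ≅ (dualCog k).obj (Opposite.op ((dualAlg k).obj (Opposite.op C))) :=
  (pointedCog k).isoMk (bidualEquiv k C.obj).toCoalgIso

/-- An isomorphism of topological algebras, as an isomorphism in the category of pseudocompact
algebras. -/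
def PCAlg.isoOfEquiv {A B : PCAlg k} (e : A.carrier ≃A[k] B.carrier) : A ≅ B where
  hom := (e : A.carrier →A[k] B.carrier)
  inv := (e.symm : B.carrier →A[k] A.carrier)
  hom_inv_id := ContinuousAlgHom.ext fun a => e.symm_apply_apply a
  inv_hom_id := ContinuousAlgHom.ext fun b => e.apply_symm_apply b

/-- A pointed pseudocompact algebra is isomorphic to its bidual. -/
def bidualAlgIso (A : PAlg k) :
    A ≅ (dualAlg k).obj (Opposite.op ((dualCog k).obj (Opposite.op A))) :=
  (pointedAlg k).isoMk (PCAlg.isoOfEquiv (bidualAlgEquiv k A.obj.carrier))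

theorem bidualIso_naturality {C D : PCog k} (ρ : C ⟶ D) :
    ρ ≫ (bidualIso D).hom =
      (bidualIso C).hom ≫ (dualCog k).map ((dualAlg k).map ρ.op).op := rfl

theorem bidualAlgIso_naturality {A B : PAlg k} (α : A ⟶ B) :
    α ≫ (bidualAlgIso B).hom =
      (bidualAlgIso A).hom ≫ (dualAlg k).map ((dualCog k).map α.op).op := rfl

variable (k)

/-- The duality between pointed coalgebras and pointed pseudocompact algebras. -/
def duality : (PCog k)ᵒᵖ ≌ PAlg k :=
  CategoryTheory.Equivalence.mk (dualAlg k) (dualCog k).rightOp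
    (NatIso.ofComponents (fun C => (bidualIso C.unop).symm.op) fun {C D} ρ => by
      apply Quiver.Hom.unop_inj
      change (bidualIso D.unop).inv ≫ ρ.unop = (dualCog k).map ((dualAlg k).map ρ).op ≫
        (bidualIso C.unop).inv
      rw [Iso.inv_comp_eq, ← Category.assoc, Iso.eq_comp_inv]
      exact bidualIso_naturality ρ.unop)
    (NatIso.ofComponents (fun A => (bidualAlgIso A).symm) fun {A B} α => by
      change (dualAlg k).map ((dualCog k).map α.op).op ≫ (bidualAlgIso B).inv =
        (bidualAlgIso A).inv ≫ α
      rw [Iso.eq_inv_comp, ← Category.assoc, Iso.comp_inv_eq]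
      exact (bidualAlgIso_naturality α).symm)

/-- The functor induced by `(-)*` from the quotient of `PCog` to the quotient of `PAlg`. -/
def dualAlgSim : (PCogSim k)ᵒᵖ ⥤ PAlgSim k :=
  (CategoryTheory.Quotient.lift (simCog k)
    ((dualAlg k).rightOp ⋙ (CategoryTheory.Quotient.functor (simAlg k)).op)
    fun _ _ ρ γ h => congrArg Quiver.Hom.op
      (CategoryTheory.Quotient.sound (simAlg k) ((simCog_iff ρ γ).1 h))).leftOp

/-- The functor induced by `(-)*` from the quotient of `PAlg` to the quotient of `PCog`. -/
def dualCogSim : (PAlgSim k)ᵒᵖ ⥤ PCogSim k :=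
  (CategoryTheory.Quotient.lift (simAlg k)
    ((dualCog k).rightOp ⋙ (CategoryTheory.Quotient.functor (simCog k)).op)
    fun _ _ α β h => congrArg Quiver.Hom.op
      (CategoryTheory.Quotient.sound (simCog k) ((simAlg_iff α β).1 h))).leftOp

/-- The duality between the quotient categories. -/
def dualitySim : (PCogSim k)ᵒᵖ ≌ PAlgSim k :=
  CategoryTheory.Equivalence.mk (dualAlgSim k) (dualCogSim k).rightOp
    (NatIso.ofComponents
      (fun C => ((CategoryTheory.Quotient.functor (simCog k)).mapIso (bidualIso C.unop.as)).symm.op)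
      fun {C D} ρ => by
        obtain ⟨ρ⟩ := ρ
        -- Every morphism of the quotient lifts, so naturality is the image of the naturality in
        -- `duality`.
        obtain ⟨ρ, rfl⟩ := (CategoryTheory.Quotient.functor (simCog k)).map_surjective ρ
        exact congrArg (fun f => ((CategoryTheory.Quotient.functor (simCog k)).map f).op)
          (Quiver.Hom.op_inj ((duality k).unitIso.hom.naturality ρ.op)))
    (NatIso.ofComponents
      (fun A => ((CategoryTheory.Quotient.functor (simAlg k)).mapIso (bidualAlgIso A.as)).symm)
      fun {A B} α => by
        obtain ⟨α, rfl⟩ := (CategoryTheory.Quotient.functor (simAlg k)).map_surjective α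
        exact congrArg (CategoryTheory.Quotient.functor (simAlg k)).map
          ((duality k).counitIso.hom.naturality α))

end Duality

end PointedDuality

end

theorem proposition4p2 (k : Type u) [Field k] :
    Congruence (simCog k) ∧ Congruence (simAlg k) ∧
    ∃ (hD : ∀ C : CoalgCat.{u} k, pointedCog k C →
        pointedAlg k ((dualAlgFunctor k).obj (Opposite.op C)))
      (hE : ∀ A : PCAlg k, pointedAlg k A →
        pointedCog k ((dualCogFunctor k).obj (Opposite.op A))),
      -- the functors `(-)*` form a duality between `PCog` and `PAlg`
      (∃ e : (PCog k)ᵒᵖ ≌ PAlg k,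
        e.functor = pointedDualAlg hD ∧ e.inverse = (pointedDualCog hE).rightOp) ∧
      -- they preserve and reflect the congruences
      (∀ (C D : PCog k) (ρ γ : C ⟶ D), simCog k ρ γ ↔
        simAlg k ((pointedDualAlg hD).map ρ.op) ((pointedDualAlg hD).map γ.op)) ∧
      (∀ (A B : PAlg k) (α β : A ⟶ B), simAlg k α β ↔
        simCog k ((pointedDualCog hE).map α.op) ((pointedDualCog hE).map β.op)) ∧
      -- the functors they induce form a duality between the quotient categories
      ∃ (F : (PCogSim k)ᵒᵖ ⥤ PAlgSim k) (G : (PAlgSim k)ᵒᵖ ⥤ PCogSim k),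
        (CategoryTheory.Quotient.functor (simCog k)).op ⋙ F =
          pointedDualAlg hD ⋙ CategoryTheory.Quotient.functor (simAlg k) ∧
        (CategoryTheory.Quotient.functor (simAlg k)).op ⋙ G =
          pointedDualCog hE ⋙ CategoryTheory.Quotient.functor (simCog k) ∧
        ∃ e : (PCogSim k)ᵒᵖ ≌ PAlgSim k, e.functor = F ∧ e.inverse = G.rightOp := by
  refine ⟨congruence_simCog k, congruence_simAlg k, pointedAlg_dual k, pointedCog_dual k,
    ⟨duality k, rfl, rfl⟩, fun _ _ => simCog_iff, fun _ _ => simAlg_iff,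
    dualAlgSim k, dualCogSim k, rfl, rfl, dualitySim k, rfl, rfl⟩
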